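/- Let $(M,\mathbf g)$ be a smooth (Hausdorff) pseudo-Riemannian manifold of dimension $n$, with Levi-Civita connection $\nabla$, Laplace–Beltrami operator $\Delta=\nabla_a g^{ab}\nabla_b$ and Ricci tensor $\mathbf R$ (with the sign for which round spheres have positive Ricci curvature). Let $\mathbf K=(K^{ab})$ be a smooth symmetric contravariant 2-tensor field on $M$, let $\hbar\neq 0$ be a real number, and let $E,V,E_K,V_K$ be smooth real functions on $M$. Put $\Delta_K=\nabla_aK^{ab}\nabla_b$ and consider the operators $$\widehat H_E=-\frac{\hbar^2}{2}(\Delta+E)+V,\qquad \widehat K_{E_K}=-\frac{\hbar^2}{2}(\Delta_K+E_K)+V_K$$ on the smooth functions on $M$. Then $[\widehat H_E,\widehat K_{E_K}]=0$ if and only if both of the following hold: 1. $\mathbf K$ is a Killing tensor, that is, $\nabla^{(a}K^{bc)}=0$; 2. $$\frac{\hbar^2}{6}\,\delta\mathbf C_K+\frac{\hbar^2}{2}\left(\nabla E_K-\mathbf K\nabla E\right)+\mathbf K\nabla V-\nabla V_K=0.$$ Here $\mathbf C_K=\mathbf K\mathbf R-\mathbf R\mathbf K$, i.e. $C_K^{ab}=K^{ac}R_c{}^{b}-R^{a}{}_{c}K^{cb}$,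 $(\delta\mathbf C_K)^a=\nabla_bC_K^{ba}$, $(\nabla F)^a=g^{ab}\partial_bF$ and $(\mathbf K\nabla F)^a=K^{ab}\partial_bF$ for a function $F$. -/

import Mathlib

open scoped Manifold ContDiff Matrix

noncomputable section

/-! ### Tensor calculus in coordinates

The functions below are defined on (an open part of) `ℝⁿ`.  `g` is the matrix of covariant components
`g_{ab}` of a metric, `K` the matrix of contravariant components `K^{ab}` of a 2-tensor. -/

namespace Coord

variable {n : ℕ}

/-- The partial derivative `∂_a F`. -/
def partialDeriv (a : Fin n) (F : EuclideanSpace ℝ (Fin n) → ℝ) (y : EuclideanSpace ℝ (Fin n)) : ℝ :=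
  fderiv ℝ F y (EuclideanSpace.single a 1)

/-- The contravariant components `g^{ab}` of the metric. -/
def metricInv (g : EuclideanSpace ℝ (Fin n) → Matrix (Fin n) (Fin n) ℝ)
    (y : EuclideanSpace ℝ (Fin n)) : Matrix (Fin n) (Fin n) ℝ :=
  (g y)⁻¹

/-- The Christoffel symbols of the Levi-Civita connection,
`Γ^a_{bc} = ½ g^{ad} (∂_b g_{dc} + ∂_c g_{db} - ∂_d g_{bc})`. -/
def christoffel (g : EuclideanSpace ℝ (Fin n) → Matrix (Fin n) (Fin n) ℝ) (a b c : Fin n)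
    (y : EuclideanSpace ℝ (Fin n)) : ℝ :=
  (1 / 2 : ℝ) * ∑ d, metricInv g y a d *
    (partialDeriv b (fun z => g z d c) y + partialDeriv c (fun z => g z d b) y
      - partialDeriv d (fun z => g z b c) y)

/-- The Riemann tensor
`R^a_{bcd} = ∂_c Γ^a_{db} - ∂_d Γ^a_{cb} + Γ^a_{ce} Γ^e_{db} - Γ^a_{de} Γ^e_{cb}`. -/
def riemann (g : EuclideanSpace ℝ (Fin n) → Matrix (Fin n) (Fin n) ℝ) (a b c d : Fin n)
    (y : EuclideanSpace ℝ (Fin n)) : ℝ :=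
  partialDeriv c (christoffel g a d b) y - partialDeriv d (christoffel g a c b) y
    + ∑ e, (christoffel g a c e y * christoffel g e d b y
      - christoffel g a d e y * christoffel g e c b y)

/-- The covariant components `R_{bd} = R^a_{bad}` of the Ricci tensor (positive on spheres). -/
def ricci (g : EuclideanSpace ℝ (Fin n) → Matrix (Fin n) (Fin n) ℝ)
    (y : EuclideanSpace ℝ (Fin n)) : Matrix (Fin n) (Fin n) ℝ :=
  Matrix.of fun b d => ∑ a, riemann g a b a d y

/-- The covariant derivative `∇_c T^{ab}` of a contravariant 2-tensor. -/
def covDeriv (g T : EuclideanSpace ℝ (Fin n) → Matrix (Fin n) (Fin n) ℝ) (c a b : Fin n)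
    (y : EuclideanSpace ℝ (Fin n)) : ℝ :=
  partialDeriv c (fun z => T z a b) y
    + ∑ d, (christoffel g a c d y * T y d b + christoffel g b c d y * T y a d)

/-- The covariant derivative with its index raised, `∇^c T^{ab} = g^{cd} ∇_d T^{ab}`. -/
def covDerivUp (g T : EuclideanSpace ℝ (Fin n) → Matrix (Fin n) (Fin n) ℝ) (c a b : Fin n)
    (y : EuclideanSpace ℝ (Fin n)) : ℝ :=
  ∑ d, metricInv g y c d * covDeriv g T d a b y

/-- The divergence `∇_a X^a` of a vector field. -/
def divVector (g : EuclideanSpace ℝ (Fin n) → Matrix (Fin n) (Fin n) ℝ)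
    (X : EuclideanSpace ℝ (Fin n) → Fin n → ℝ) (y : EuclideanSpace ℝ (Fin n)) : ℝ :=
  ∑ a, (partialDeriv a (fun z => X z a) y + ∑ c, christoffel g a a c y * X y c)

/-- The divergence `(δ T)^a = ∇_b T^{ba}` of a contravariant 2-tensor. -/
def divTensor (g T : EuclideanSpace ℝ (Fin n) → Matrix (Fin n) (Fin n) ℝ)
    (y : EuclideanSpace ℝ (Fin n)) (a : Fin n) : ℝ :=
  ∑ b, covDeriv g T b b a y

/-- The vector field `(K ∇F)^a = K^{ab} ∂_b F`. -/
def tensorGrad (K : EuclideanSpace ℝ (Fin n) → Matrix (Fin n) (Fin n) ℝ)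
    (F : EuclideanSpace ℝ (Fin n) → ℝ) (y : EuclideanSpace ℝ (Fin n)) (a : Fin n) : ℝ :=
  ∑ b, K y a b * partialDeriv b F y

/-- The gradient `(∇F)^a = g^{ab} ∂_b F`. -/
def grad (g : EuclideanSpace ℝ (Fin n) → Matrix (Fin n) (Fin n) ℝ)
    (F : EuclideanSpace ℝ (Fin n) → ℝ) (y : EuclideanSpace ℝ (Fin n)) (a : Fin n) : ℝ :=
  tensorGrad (metricInv g) F y a

/-- The operator `Δ_K F = ∇_a (K^{ab} ∇_b F)`. -/
def tensorLaplacian (g K : EuclideanSpace ℝ (Fin n) → Matrix (Fin n) (Fin n) ℝ)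
    (F : EuclideanSpace ℝ (Fin n) → ℝ) (y : EuclideanSpace ℝ (Fin n)) : ℝ :=
  divVector g (tensorGrad K F) y

/-- The contravariant components `C^{ab} = K^{ac} R_c^b - R^a_c K^{cb}` of `C_K = K R - R K`. -/
def ricciCommutator (g K : EuclideanSpace ℝ (Fin n) → Matrix (Fin n) (Fin n) ℝ)
    (y : EuclideanSpace ℝ (Fin n)) : Matrix (Fin n) (Fin n) ℝ :=
  K y * ricci g y * metricInv g y - metricInv g y * ricci g y * K y

end Coord

/-! ### Tensors on a manifold -/

section Manifold

variable {n : ℕ} {M : Type*} [TopologicalSpace M] [ChartedSpace (EuclideanSpace ℝ (Fin n)) M]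

/-- The components `g_{ij} = g(∂_i, ∂_j)`, in the coordinates of a chart, of a family of bilinear
forms on the tangent spaces. -/
def covariantComponents
    (g : ∀ x : M, TangentSpace (𝓡 n) x →L[ℝ] TangentSpace (𝓡 n) x →L[ℝ] ℝ)
    (φ : OpenPartialHomeomorph M (EuclideanSpace ℝ (Fin n))) (y : EuclideanSpace ℝ (Fin n)) :
    Matrix (Fin n) (Fin n) ℝ :=
  Matrix.of fun i j => g (φ.symm y)
    (mfderiv (𝓡 n) (𝓡 n) φ.symm y (EuclideanSpace.single i (1 : ℝ)))
    (mfderiv (𝓡 n) (𝓡 n) φ.symm y (EuclideanSpace.single j (1 : ℝ)))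

/-- The covector `dx^i` at the point with coordinates `y` in a chart. -/
def coordCovector (φ : OpenPartialHomeomorph M (EuclideanSpace ℝ (Fin n)))
    (y : EuclideanSpace ℝ (Fin n)) (i : Fin n) : TangentSpace (𝓡 n) (φ.symm y) →L[ℝ] ℝ :=
  (EuclideanSpace.proj i : EuclideanSpace ℝ (Fin n) →L[ℝ] ℝ).comp
    (mfderiv (𝓡 n) (𝓡 n) φ (φ.symm y))

/-- The components `K^{ij} = K(dx^i, dx^j)`, in the coordinates of a chart, of a family of bilinear
forms on the cotangent spaces. -/
def contravariantComponents
    (K : ∀ x : M, (TangentSpace (𝓡 n) x →L[ℝ] ℝ) →L[ℝ] (TangentSpace (𝓡 n) x →L[ℝ] ℝ) →L[ℝ] ℝ)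
    (φ : OpenPartialHomeomorph M (EuclideanSpace ℝ (Fin n))) (y : EuclideanSpace ℝ (Fin n)) :
    Matrix (Fin n) (Fin n) ℝ :=
  Matrix.of fun i j => K (φ.symm y) (coordCovector φ y i) (coordCovector φ y j)

variable (n M) in
/-- A smooth pseudo-Riemannian metric on `M`, of arbitrary signature.  Smoothness means that the
components in each chart are smooth. -/
structure PseudoRiemannianMetric where
  /-- The bilinear form on each tangent space. -/
  toFun (x : M) : TangentSpace (𝓡 n) x →L[ℝ] TangentSpace (𝓡 n) x →L[ℝ] ℝ
  symm (x : M) (v w : TangentSpace (𝓡 n) x) : toFun x v w = toFun x w v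
  nondegenerate (x : M) (v : TangentSpace (𝓡 n) x) : (∀ w, toFun x v w = 0) → v = 0
  smooth (φ : OpenPartialHomeomorph M (EuclideanSpace ℝ (Fin n)))
    (hφ : φ ∈ atlas (EuclideanSpace ℝ (Fin n)) M) (i j : Fin n) :
    ContDiffOn ℝ ∞ (fun y => covariantComponents toFun φ y i j) φ.target

variable (n M) in
/-- A smooth symmetric contravariant 2-tensor field on `M`: a symmetric bilinear form on each
cotangent space, whose components in each chart are smooth. -/
structure SymmetricTwoTensor where
  /-- The bilinear form on each cotangent space. -/
  toFun (x : M) : (TangentSpace (𝓡 n) x →L[ℝ] ℝ) →L[ℝ] (TangentSpace (𝓡 n) x →L[ℝ] ℝ) →L[ℝ] ℝ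
  symm (x : M) (α β : TangentSpace (𝓡 n) x →L[ℝ] ℝ) : toFun x α β = toFun x β α
  smooth (φ : OpenPartialHomeomorph M (EuclideanSpace ℝ (Fin n)))
    (hφ : φ ∈ atlas (EuclideanSpace ℝ (Fin n)) M) (i j : Fin n) :
    ContDiffOn ℝ ∞ (fun y => contravariantComponents toFun φ y i j) φ.target

/-- The covariant components `g_{ij}` of a metric in the coordinates of a chart. -/
def PseudoRiemannianMetric.components (g : PseudoRiemannianMetric n M)
    (φ : OpenPartialHomeomorph M (EuclideanSpace ℝ (Fin n))) (y : EuclideanSpace ℝ (Fin n)) :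
    Matrix (Fin n) (Fin n) ℝ :=
  covariantComponents g.toFun φ y

/-- The contravariant components `K^{ij}` of a tensor in the coordinates of a chart. -/
def SymmetricTwoTensor.components (K : SymmetricTwoTensor n M)
    (φ : OpenPartialHomeomorph M (EuclideanSpace ℝ (Fin n))) (y : EuclideanSpace ℝ (Fin n)) :
    Matrix (Fin n) (Fin n) ℝ :=
  contravariantComponents K.toFun φ y

/-- `Δ f` at the point `x`, computed in the chart `φ` around `x`. -/
def laplaceBeltramiInChart (g : PseudoRiemannianMetric n M)
    (φ : OpenPartialHomeomorph M (EuclideanSpace ℝ (Fin n))) (f : M → ℝ) (x : M) : ℝ :=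
  Coord.tensorLaplacian (g.components φ) (Coord.metricInv (g.components φ)) (f ∘ φ.symm) (φ x)

/-- `Δ_K f` at the point `x`, computed in the chart `φ` around `x`. -/
def tensorLaplaceBeltramiInChart (g : PseudoRiemannianMetric n M) (K : SymmetricTwoTensor n M)
    (φ : OpenPartialHomeomorph M (EuclideanSpace ℝ (Fin n))) (f : M → ℝ) (x : M) : ℝ :=
  Coord.tensorLaplacian (g.components φ) (K.components φ) (f ∘ φ.symm) (φ x)

/-- The Laplace-Beltrami operator `Δ` on functions on `M`. Its value at `x` does not depend on the
chart around `x`. -/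
def laplaceBeltrami (g : PseudoRiemannianMetric n M) (f : M → ℝ) (x : M) : ℝ :=
  laplaceBeltramiInChart g (chartAt (EuclideanSpace ℝ (Fin n)) x) f x

/-- The operator `Δ_K = ∇_a K^{ab} ∇_b` on functions on `M`. Its value at `x` does not depend on the
chart around `x`. -/
def tensorLaplaceBeltrami (g : PseudoRiemannianMetric n M) (K : SymmetricTwoTensor n M)
    (f : M → ℝ) (x : M) : ℝ :=
  tensorLaplaceBeltramiInChart g K (chartAt (EuclideanSpace ℝ (Fin n)) x) f x

/-- The operator `-(ħ²/2)(Δ + E) + V`. -/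
def modifiedHamiltonian (ħ : ℝ) (g : PseudoRiemannianMetric n M) (E V : M → ℝ) (f : M → ℝ) (x : M) :
    ℝ :=
  -(ħ ^ 2 / 2) * (laplaceBeltrami g f x + E x * f x) + V x * f x

/-- The operator `-(ħ²/2)(Δ_K + E_K) + V_K`. -/
def modifiedOperator (ħ : ℝ) (g : PseudoRiemannianMetric n M) (K : SymmetricTwoTensor n M)
    (EK VK : M → ℝ) (f : M → ℝ) (x : M) : ℝ :=
  -(ħ ^ 2 / 2) * (tensorLaplaceBeltrami g K f x + EK x * f x) + VK x * f x

/-- Two operators commute on the smooth functions on `M`. -/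
def CommuteOnSmooth (A B : (M → ℝ) → M → ℝ) : Prop :=
  ∀ f : M → ℝ, ContMDiff (𝓡 n) 𝓘(ℝ) ∞ f → A (B f) = B (A f)

/-- `K` is a Killing tensor: in every chart, the symmetric part of `∇^c K^{ab}` vanishes. -/
def IsKillingTensor (g : PseudoRiemannianMetric n M) (K : SymmetricTwoTensor n M) : Prop :=
  ∀ φ ∈ atlas (EuclideanSpace ℝ (Fin n)) M, ∀ y ∈ φ.target, ∀ a b c : Fin n,
    Coord.covDerivUp (g.components φ) (K.components φ) a b c y
      + Coord.covDerivUp (g.components φ) (K.components φ) b c a y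
      + Coord.covDerivUp (g.components φ) (K.components φ) c a b y = 0

/-- The vector equation
`(ħ²/6) δC_K + (ħ²/2) (∇E_K - K ∇E) + K ∇V - ∇V_K = 0`, in components in every chart. -/
def QuantumCorrectionEquation (ħ : ℝ) (g : PseudoRiemannianMetric n M) (K : SymmetricTwoTensor n M)
    (E V EK VK : M → ℝ) : Prop :=
  ∀ φ ∈ atlas (EuclideanSpace ℝ (Fin n)) M, ∀ y ∈ φ.target, ∀ a : Fin n,
    ħ ^ 2 / 6 * Coord.divTensor (g.components φ)
        (Coord.ricciCommutator (g.components φ) (K.components φ)) y a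
      + ħ ^ 2 / 2 * (Coord.grad (g.components φ) (EK ∘ φ.symm) y a
        - Coord.tensorGrad (K.components φ) (E ∘ φ.symm) y a)
      + Coord.tensorGrad (K.components φ) (V ∘ φ.symm) y a
      - Coord.grad (g.components φ) (VK ∘ φ.symm) y a = 0

end Manifold

end

/-!
The theorem is local: `Δ` and `Δ_K` do not depend on the chart (`tensorLaplacian_transition`), so
the two operators commute exactly when their coordinate expressions commute in every chart, on the
expressions of globally smooth functions. Bump functions provide enough of these
(`exists_smooth_coordinate`).

In a chart everything is algebra: the tensor calculus takes place in a commutative `ℝ`-algebra with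
`n` commuting derivations and a symmetric invertible matrix `g` (`MetricAlgebra`), which is then
specialised to the smooth functions on the range of the chart. Write `c = ħ²/2`, `f_a = ∂_a f` and
`N^{cab} = ∇^c K^{ab}`.

* For every symmetric `K`, the full commutator is
  `c² [Δ, Δ_K] f + 2c X^a f_a + c f ∇_a X^a` with `X = c (∇E_K - K ∇E) + K ∇V - ∇V_K`
  (`MetricAlgebra.op_commutator`).
* Also for every `K`, the contracted Ricci identity gives
  `[Δ, Δ_K] f = ∇_a (C^{ab} f_b + ∇_c (N^{cab} f_b) + N^{cab} ∇_c f_b)`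
  (`MetricAlgebra.lap_commutator`). On a product of three functions that vanish at a point, its
  value at this point is a multiple of the symmetrised `N`; hence commuting operators force `K` to
  be Killing (`MetricAlgebra.eval_op_commutator_mul`).
* If `K` is Killing, then `3 [Δ, Δ_K] f = 2 (δC)^a f_a` (`MetricAlgebra.IsKilling.lap_commutator`).
  A double divergence `∇_a ∇_b T^{ab}` sees only the symmetric part of `T`. This and the Killing
  equation turn the last two terms into multiples of `∇_c ((M^{ac} - M^{ca}) f_a)`, where
  `M^{ac} = ∇_b ∇^a K^{bc}`. The divergence of a Killing tensor is a gradient and the Riemann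
  contraction `K^{be} R^c_{eb}{}^a` is symmetric in `a, c`, so that `M^{ac} - M^{ca} = -C^{ac}`.
* Hence, for Killing `K`, three times the commutator is `2c Z^a f_a + c f ∇_a Z^a`, where `Z` is
  three times the left side of the vector equation; here `∇_a (δC)^a = 0` because `C` is
  antisymmetric. It vanishes for all `f` if and only if `Z = 0`.
-/

/-! ### Tensor calculus in a differential ring -/

/-- A commutative `ℝ`-algebra `A` with `n` commuting derivations and a symmetric invertible matrix
over `A`. The example to have in mind is the ring of smooth functions on the domain of a chart, with
the partial derivatives and the components of a metric. -/
structure MetricAlgebra (n : ℕ) (A : Type*) [CommRing A] [Algebra ℝ A] where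
  /-- The partial derivatives. -/
  d : Fin n → Derivation ℝ A A
  d_comm (i j : Fin n) (x : A) : d i (d j x) = d j (d i x)
  /-- The covariant components of the metric. -/
  g : Matrix (Fin n) (Fin n) A
  /-- The contravariant components of the metric. -/
  G : Matrix (Fin n) (Fin n) A
  g_symm : gᵀ = g
  g_mul_G : g * G = 1

namespace MetricAlgebra

variable {n : ℕ} {A : Type*} [CommRing A] [Algebra ℝ A] (S : MetricAlgebra n A)

/-- Entrywise partial derivative of a matrix. -/
def dM (c : Fin n) (M : Matrix (Fin n) (Fin n) A) : Matrix (Fin n) (Fin n) A :=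
  Matrix.of fun a b => S.d c (M a b)

/-- Entrywise partial derivative of a family of functions. -/
def dV (c : Fin n) (v : Fin n → A) : Fin n → A := fun a => S.d c (v a)

/-- The differential of a function. -/
def df (f : A) : Fin n → A := fun a => S.d a f

theorem eq_of_add_self_eq {R : Type*} [AddCommGroup R] [Module ℝ R] {x y : R}
    (h : x + x = y + y) : x = y := by
  rw [← two_smul ℝ, ← two_smul ℝ] at h
  exact smul_right_injective R (two_ne_zero (α := ℝ)) h

theorem dM_apply (c : Fin n) (M : Matrix (Fin n) (Fin n) A) (a b : Fin n) :
    S.dM c M a b = S.d c (M a b) := rfl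

theorem dM_add (c : Fin n) (M N : Matrix (Fin n) (Fin n) A) :
    S.dM c (M + N) = S.dM c M + S.dM c N := by
  ext a b; simp [dM]

theorem dM_mul (c : Fin n) (M N : Matrix (Fin n) (Fin n) A) :
    S.dM c (M * N) = S.dM c M * N + M * S.dM c N := by
  ext a b
  simp only [dM, Matrix.of_apply, Matrix.mul_apply, map_sum, Derivation.leibniz, smul_eq_mul,
    Matrix.add_apply, ← Finset.sum_add_distrib]
  exact Finset.sum_congr rfl fun _ _ => by ring

theorem dM_transpose (c : Fin n) (M : Matrix (Fin n) (Fin n) A) : S.dM c Mᵀ = (S.dM c M)ᵀ := rfl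

theorem dM_one (c : Fin n) : S.dM c 1 = 0 := by
  ext a b
  by_cases h : a = b <;> simp [dM, h]

theorem dM_comm (c e : Fin n) (M : Matrix (Fin n) (Fin n) A) :
    S.dM c (S.dM e M) = S.dM e (S.dM c M) := by
  ext a b; exact S.d_comm _ _ _

theorem dV_add (c : Fin n) (v w : Fin n → A) : S.dV c (v + w) = S.dV c v + S.dV c w := by
  ext a; simp [dV]

theorem dV_mulVec (c : Fin n) (M : Matrix (Fin n) (Fin n) A) (v : Fin n → A) :
    S.dV c (M *ᵥ v) = S.dM c M *ᵥ v + M *ᵥ S.dV c v := by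
  ext a
  simp only [dM, dV, Matrix.of_apply, Matrix.mulVec, dotProduct, map_sum, Derivation.leibniz,
    smul_eq_mul, Pi.add_apply, ← Finset.sum_add_distrib]
  exact Finset.sum_congr rfl fun _ _ => by ring

theorem G_mul_g : S.G * S.g = 1 := mul_eq_one_comm.mp S.g_mul_G

theorem g_symm_apply (a b : Fin n) : S.g a b = S.g b a := congrFun (congrFun S.g_symm b) a

theorem G_symm : S.Gᵀ = S.G := by
  have h : S.Gᵀ * S.g = 1 := by
    have := congrArg Matrix.transpose S.g_mul_G
    rwa [Matrix.transpose_mul, S.g_symm, Matrix.transpose_one] at this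
  calc S.Gᵀ = S.Gᵀ * (S.g * S.G) := by rw [S.g_mul_G, mul_one]
    _ = S.G := by rw [← mul_assoc, h, one_mul]

theorem G_symm_apply (a b : Fin n) : S.G a b = S.G b a := congrFun (congrFun S.G_symm b) a

/-! ### The Levi-Civita connection and its curvature -/

/-- Twice the Christoffel symbols of the first kind, as matrices:
`B_c = (∂_c g_{ab} + ∂_b g_{ac} - ∂_a g_{cb})_{ab}`. -/
def firstKind (c : Fin n) : Matrix (Fin n) (Fin n) A :=
  Matrix.of fun a b => S.d c (S.g a b) + S.d b (S.g a c) - S.d a (S.g c b)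

/-- The connection matrices `Γ_c = (Γ^a_{cb})_{ab}`. -/
noncomputable def Γ (c : Fin n) : Matrix (Fin n) (Fin n) A := (1 / 2 : ℝ) • (S.G * S.firstKind c)

/-- The contracted Christoffel symbols `γ_c = Γ^a_{ca}`. -/
noncomputable def γ (c : Fin n) : A := (S.Γ c).trace

/-- The curvature matrices `F_{cd} = (R^a_{bcd})_{ab}`. -/
noncomputable def F (c e : Fin n) : Matrix (Fin n) (Fin n) A :=
  S.dM c (S.Γ e) - S.dM e (S.Γ c) + (S.Γ c * S.Γ e - S.Γ e * S.Γ c)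

/-- The Ricci tensor. -/
noncomputable def ric : Matrix (Fin n) (Fin n) A := Matrix.of fun b e => ∑ a, S.F a e a b

theorem g_mul_Γ (c : Fin n) : S.g * S.Γ c = (1 / 2 : ℝ) • S.firstKind c := by
  rw [Γ, Matrix.mul_smul, ← mul_assoc, S.g_mul_G, one_mul]

theorem Γ_torsion (a b c : Fin n) : S.Γ c a b = S.Γ b a c := by
  simp only [Γ, Matrix.smul_apply, Matrix.mul_apply, firstKind, Matrix.of_apply]
  congr 1
  refine Finset.sum_congr rfl fun e _ => ?_
  rw [S.g_symm_apply c b]; ring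

/-- The connection is metric. -/
theorem dM_g (c : Fin n) : S.dM c S.g = (S.Γ c)ᵀ * S.g + S.g * S.Γ c := by
  have h : (S.Γ c)ᵀ * S.g = (S.g * S.Γ c)ᵀ := by rw [Matrix.transpose_mul, S.g_symm]
  rw [h, g_mul_Γ]
  ext a b
  simp only [dM, firstKind, Matrix.of_apply, Matrix.add_apply, Matrix.transpose_apply,
    Matrix.smul_apply]
  rw [S.g_symm_apply b a, S.g_symm_apply b c, S.g_symm_apply a c]
  module

theorem dM_G (c : Fin n) : S.dM c S.G = -(S.Γ c * S.G) - S.G * (S.Γ c)ᵀ := by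
  have h := congrArg (S.dM c) S.g_mul_G
  rw [dM_mul, dM_one, dM_g] at h
  have h2 : S.G * (((S.Γ c)ᵀ * S.g + S.g * S.Γ c) * S.G + S.g * S.dM c S.G) = 0 := by
    rw [h, mul_zero]
  have e : S.G * (((S.Γ c)ᵀ * S.g + S.g * S.Γ c) * S.G + S.g * S.dM c S.G)
      = S.G * (S.Γ c)ᵀ * (S.g * S.G) + (S.G * S.g) * S.Γ c * S.G + (S.G * S.g) * S.dM c S.G := by
    noncomm_ring
  rw [e, S.g_mul_G, S.G_mul_g, mul_one, one_mul, one_mul] at h2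
  rw [← sub_eq_zero, ← h2]
  abel

/-- Antisymmetry of the Riemann tensor in its first pair of indices. -/
theorem g_mul_F (c e : Fin n) : S.g * S.F c e + (S.F c e)ᵀ * S.g = 0 := by
  have h := S.dM_comm c e S.g
  rw [dM_g, dM_g, dM_add, dM_add, dM_mul, dM_mul, dM_mul, dM_mul, dM_transpose, dM_transpose,
    dM_g, dM_g, ← sub_eq_zero] at h
  rw [← h, F]
  simp only [Matrix.transpose_add, Matrix.transpose_sub, Matrix.transpose_mul]
  noncomm_ring

theorem F_antisymm (c e : Fin n) : S.F c e = -S.F e c := by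
  rw [F, F]; abel

theorem F_antisymm_apply (c e a b : Fin n) : S.F c e a b = -S.F e c a b :=
  congrFun (congrFun (S.F_antisymm c e) a) b

/-- The first Bianchi identity. -/
theorem bianchi (a b c e : Fin n) : S.F c e a b + S.F e b a c + S.F b c a e = 0 := by
  simp only [F, Matrix.add_apply, Matrix.sub_apply, dM_apply, Matrix.mul_apply]
  simp only [S.Γ_torsion _ b e, S.Γ_torsion _ c e, S.Γ_torsion _ c b]
  ring

theorem trace_F (c e : Fin n) : (S.F c e).trace = 0 := by
  have h : S.F c e + S.G * ((S.F c e)ᵀ * S.g) = 0 := by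
    have := congrArg (S.G * ·) (S.g_mul_F c e)
    simpa only [mul_add, ← mul_assoc, S.G_mul_g, one_mul, mul_zero] using this
  have h2 := congrArg Matrix.trace h
  rw [Matrix.trace_add, Matrix.trace_mul_comm, mul_assoc, S.g_mul_G, mul_one,
    Matrix.trace_transpose, Matrix.trace_zero] at h2
  exact eq_of_add_self_eq (h2.trans (add_zero 0).symm)

theorem d_γ (c e : Fin n) : S.d c (S.γ e) = S.d e (S.γ c) := by
  have h := S.trace_F c e
  have e1 : ∀ c e, (S.dM c (S.Γ e)).trace = S.d c (S.γ e) := fun c e => by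
    simp [γ, Matrix.trace, dM]
  rw [F, Matrix.trace_add, Matrix.trace_sub, Matrix.trace_sub, Matrix.trace_mul_comm (S.Γ c),
    sub_self, add_zero, e1, e1] at h
  exact sub_eq_zero.mp h

theorem ric_symm : S.ricᵀ = S.ric := by
  ext b e
  have h : ∀ a, S.F a b a e = S.F a e a b + S.F e b a a := fun a => by
    have h1 := S.bianchi a b a e
    rw [S.F_antisymm_apply b a] at h1
    linear_combination -h1
  have ht := S.trace_F e b
  simp only [Matrix.trace, Matrix.diag_apply] at ht
  simp only [ric, Matrix.transpose_apply, Matrix.of_apply, h, Finset.sum_add_distrib, ht, add_zero]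

theorem g_mul_F_antisymm (a b c e : Fin n) : (S.g * S.F c e) a b = -(S.g * S.F c e) b a := by
  have h := congrFun (congrFun (S.g_mul_F c e) a) b
  have h' : (S.F c e)ᵀ * S.g = (S.g * S.F c e)ᵀ := by rw [Matrix.transpose_mul, S.g_symm]
  rw [h', Matrix.add_apply, Matrix.transpose_apply] at h
  exact eq_neg_of_add_eq_zero_left h

theorem g_mul_F_swap (a b c e : Fin n) : (S.g * S.F c e) a b = (S.g * S.F e c) b a := by
  rw [g_mul_F_antisymm, S.F_antisymm c e, mul_neg, Matrix.neg_apply, neg_neg]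

/-- The symmetry `R_{abce} = R_{ceab}` of the Riemann tensor under exchange of pairs. -/
theorem pair_symm (a b c e : Fin n) : (S.g * S.F c e) a b = (S.g * S.F a b) c e := by
  have h3 : ∀ a b c e, (S.g * S.F c e) a b + (S.g * S.F e b) a c + (S.g * S.F b c) a e = 0 :=
    fun a b c e => by
      simp only [Matrix.mul_apply, ← Finset.sum_add_distrib, ← mul_add, S.bianchi, mul_zero,
        Finset.sum_const_zero]
  have h := S.g_mul_F_swap
  apply eq_of_add_self_eq
  linear_combination h3 a b c e + h3 b a e c - h3 c e a b - h3 e c b a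
    + h a b c e - h c e a b - h b e c a + h c a b e + h e a c b + h c b e a

/-! ### Covariant derivatives and divergences -/

/-- The covariant derivative `∇_c X^a` of a vector field. -/
noncomputable def cv (c : Fin n) (X : Fin n → A) : Fin n → A := S.dV c X + S.Γ c *ᵥ X

/-- The covariant derivative `∇_c s_a` of a covector field. -/
noncomputable def cf (c : Fin n) (s : Fin n → A) : Fin n → A := S.dV c s - (S.Γ c)ᵀ *ᵥ s

/-- The covariant derivative `∇_c T^{ab}` of a contravariant 2-tensor. -/
noncomputable def ct (c : Fin n) (T : Matrix (Fin n) (Fin n) A) : Matrix (Fin n) (Fin n) A :=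
  S.dM c T + S.Γ c * T + T * (S.Γ c)ᵀ

theorem ct_G (c : Fin n) : S.ct c S.G = 0 := by
  rw [ct, dM_G]; abel

theorem ct_transpose (c : Fin n) (T : Matrix (Fin n) (Fin n) A) : S.ct c Tᵀ = (S.ct c T)ᵀ := by
  simp only [ct, dM_transpose, Matrix.transpose_add, Matrix.transpose_mul,
    Matrix.transpose_transpose]
  abel

theorem cv_add (c : Fin n) (X Y : Fin n → A) : S.cv c (X + Y) = S.cv c X + S.cv c Y := by
  simp only [cv, dV_add, Matrix.mulVec_add]; abel

theorem cv_mulVec (c : Fin n) (T : Matrix (Fin n) (Fin n) A) (s : Fin n → A) :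
    S.cv c (T *ᵥ s) = S.ct c T *ᵥ s + T *ᵥ S.cf c s := by
  simp only [cv, cf, ct, dV_mulVec, Matrix.add_mulVec, Matrix.mulVec_sub, Matrix.mulVec_mulVec]
  abel

/-- The Hessian of a function is symmetric. -/
theorem cf_df_symm (f : A) (b c : Fin n) : S.cf b (S.df f) c = S.cf c (S.df f) b := by
  simp only [cf, df, dV, Pi.sub_apply, Matrix.mulVec, dotProduct, Matrix.transpose_apply,
    S.Γ_torsion _ b c, S.d_comm b c]

/-- The divergence `∇_a X^a` of a vector field. -/
noncomputable def div (X : Fin n → A) : A := ∑ a, (S.d a (X a) + S.γ a * X a)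

/-- The divergence `∇_b T^{ba}` of a contravariant 2-tensor, given by its rows. -/
noncomputable def div₂ (T : Fin n → Fin n → A) : Fin n → A := ∑ b, (S.cv b (T b) + S.γ b • T b)

/-- The divergence `∇_b s^b_a` of a mixed 2-tensor. -/
noncomputable def codiv (s : Fin n → Fin n → A) : Fin n → A := ∑ b, (S.cf b (s b) + S.γ b • s b)

/-- The divergence `∇_b N^{abc}` of a contravariant 3-tensor, given by the matrices
`(N^{abc})_{ac}`. -/
noncomputable def div₃ (N : Fin n → Matrix (Fin n) (Fin n) A) : Matrix (Fin n) (Fin n) A :=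
  ∑ b, (S.ct b (N b) + S.γ b • N b)

theorem div_add (X Y : Fin n → A) : S.div (X + Y) = S.div X + S.div Y := by
  simp only [div, Pi.add_apply, map_add, mul_add, ← Finset.sum_add_distrib]
  exact Finset.sum_congr rfl fun _ _ => by ring

theorem div_neg (X : Fin n → A) : S.div (-X) = -S.div X := by
  simp only [div, Pi.neg_apply, map_neg, mul_neg, ← Finset.sum_neg_distrib]
  exact Finset.sum_congr rfl fun _ _ => by ring

theorem div_sub (X Y : Fin n → A) : S.div (X - Y) = S.div X - S.div Y := by
  rw [sub_eq_add_neg, div_add, div_neg, sub_eq_add_neg]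

theorem div_smul (k : A) (X : Fin n → A) : S.div (k • X) = k * S.div X + S.df k ⬝ᵥ X := by
  simp only [div, Pi.smul_apply, smul_eq_mul, Derivation.leibniz, Finset.mul_sum, dotProduct, df,
    ← Finset.sum_add_distrib]
  exact Finset.sum_congr rfl fun _ _ => by ring

theorem div₂_add (T U : Fin n → Fin n → A) : S.div₂ (T + U) = S.div₂ T + S.div₂ U := by
  simp only [div₂, Pi.add_apply, cv_add, smul_add, ← Finset.sum_add_distrib]
  exact Finset.sum_congr rfl fun _ _ => by abel

theorem div₂_mulVec (N : Fin n → Matrix (Fin n) (Fin n) A) (s : Fin n → A) :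
    S.div₂ (fun b => N b *ᵥ s) = S.div₃ N *ᵥ s + ∑ b, N b *ᵥ S.cf b s := by
  simp only [div₂, div₃, cv_mulVec, Matrix.sum_mulVec, Matrix.add_mulVec, Matrix.smul_mulVec,
    ← Finset.sum_add_distrib]
  exact Finset.sum_congr rfl fun _ _ => by abel

theorem div₂_mulVec_const (K : Matrix (Fin n) (Fin n) A) (s : Fin n → Fin n → A) :
    S.div₂ (fun b => K *ᵥ s b) = (∑ b, S.ct b K *ᵥ s b) + K *ᵥ S.codiv s := by
  simp only [div₂, codiv, cv_mulVec, Matrix.mulVec_sum, Matrix.mulVec_add, Matrix.mulVec_smul,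
    ← Finset.sum_add_distrib]
  exact Finset.sum_congr rfl fun _ _ => by abel

theorem div₂_G_mulVec (s : Fin n → Fin n → A) :
    S.div₂ (fun b => S.G *ᵥ s b) = S.G *ᵥ S.codiv s := by
  simp [div₂_mulVec_const, ct_G]

/-- The second divergence of a 2-tensor sees only its symmetric part: both `Γ^a_{bc}` and
`∂_a γ_b` are symmetric. -/
theorem div_div₂_transpose (T : Fin n → Fin n → A) :
    S.div (S.div₂ T) = S.div (S.div₂ fun a b => T b a) := by
  have key : ∀ T : Fin n → Fin n → A, S.div (S.div₂ T) =
      (∑ a, ∑ b, (S.d a (S.d b (T b a)) + S.γ b * S.d a (T b a) + S.γ a * S.d b (T b a)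
        + S.d a (S.γ b) * T b a + S.γ a * S.γ b * T b a))
      + S.div fun a => ∑ b, ∑ e, S.Γ b a e * T b e := fun T => by
    have h : S.div₂ T = (fun a => ∑ b, (S.d b (T b a) + S.γ b * T b a))
        + fun a => ∑ b, ∑ e, S.Γ b a e * T b e := by
      ext a
      simp only [div₂, cv, dV, Finset.sum_apply, Pi.add_apply, Pi.smul_apply, smul_eq_mul,
        Matrix.mulVec, dotProduct, ← Finset.sum_add_distrib]
      exact Finset.sum_congr rfl fun _ _ => by ring
    rw [h, div_add]
    congr 1
    simp only [div, map_sum, map_add, Derivation.leibniz, smul_eq_mul, Finset.mul_sum,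
      ← Finset.sum_add_distrib]
    exact Finset.sum_congr rfl fun _ _ => Finset.sum_congr rfl fun _ _ => by ring
  rw [key, key]
  congr 1
  · rw [Finset.sum_comm]
    refine Finset.sum_congr rfl fun a _ => Finset.sum_congr rfl fun b _ => ?_
    rw [S.d_comm b a, S.d_γ b a]; ring
  · congr 1
    ext a
    rw [Finset.sum_comm]
    refine Finset.sum_congr rfl fun b _ => Finset.sum_congr rfl fun e _ => ?_
    rw [S.Γ_torsion]

/-- The twisted derivatives `D_c = ∂_c + Γ_c` have the curvature as commutator. -/
theorem cv_cv_sub (b c : Fin n) (X : Fin n → A) :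
    S.cv b (S.cv c X) - S.cv c (S.cv b X) = S.F b c *ᵥ X := by
  have h : S.dV b (S.dV c X) = S.dV c (S.dV b X) := by ext a; exact S.d_comm _ _ _
  simp only [cv, F, dV_add, dV_mulVec, h, Matrix.mulVec_add, Matrix.add_mulVec, Matrix.sub_mulVec,
    Matrix.mulVec_mulVec]
  abel

theorem ct_ct_sub (b c : Fin n) (T : Matrix (Fin n) (Fin n) A) :
    S.ct b (S.ct c T) - S.ct c (S.ct b T) = S.F b c * T + T * (S.F b c)ᵀ := by
  simp only [ct, F, dM_add, dM_mul, dM_transpose, S.dM_comm b c T, Matrix.transpose_add,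
    Matrix.transpose_sub, Matrix.transpose_mul]
  noncomm_ring

theorem div_eq (X : Fin n → A) : S.div X = ∑ a, (S.d a (X a) + ∑ c, S.Γ a a c * X c) := by
  simp only [div, Finset.sum_add_distrib, γ, Matrix.trace, Matrix.diag_apply, Finset.sum_mul]
  congr 1
  rw [Finset.sum_comm]
  exact Finset.sum_congr rfl fun _ _ => Finset.sum_congr rfl fun _ _ => by rw [S.Γ_torsion]

/-- The contracted Ricci identity `∇_b ∇_c X^b = ∂_c ∇_b X^b + R_{ce} X^e`. -/
theorem codiv_cv (X : Fin n → A) :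
    S.codiv (fun b c => S.cv c X b) = S.df (S.div X) + S.ric *ᵥ X := by
  ext c
  have hcurv : (S.ric *ᵥ X) c = ∑ b, (S.cv b (S.cv c X) - S.cv c (S.cv b X)) b := by
    conv_lhs => rw [← S.ric_symm]
    simp only [cv_cv_sub, Matrix.mulVec, dotProduct, Matrix.transpose_apply, ric, Matrix.of_apply,
      Finset.sum_mul]
    exact Finset.sum_comm
  have hdiv : S.div X = ∑ b, S.cv b X b := S.div_eq X
  have h1 : ∑ b, S.cv b (S.cv c X) b = ∑ b, (S.d b (S.cv c X b) + S.γ b * S.cv c X b) := by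
    rw [Finset.sum_congr rfl fun b _ => show S.cv b (S.cv c X) b = S.d b (S.cv c X b) +
      ∑ e, S.Γ b b e * S.cv c X e from rfl]
    simp only [Finset.sum_add_distrib, γ, Matrix.trace, Matrix.diag_apply, Finset.sum_mul]
    congr 1
    rw [Finset.sum_comm]
    exact Finset.sum_congr rfl fun _ _ => Finset.sum_congr rfl fun _ _ => by rw [S.Γ_torsion]
  have h2 : ∑ b, S.cv c (S.cv b X) b = S.d c (S.div X) + ∑ b, ∑ e, S.Γ b e c * S.cv e X b := by
    rw [hdiv, map_sum, ← Finset.sum_add_distrib]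
    rw [Finset.sum_congr rfl fun b _ => show S.cv c (S.cv b X) b = S.d c (S.cv b X b) +
      ∑ e, S.Γ c b e * S.cv b X e from rfl]
    simp only [Finset.sum_add_distrib]
    congr 1
    rw [Finset.sum_comm]
    exact Finset.sum_congr rfl fun _ _ => Finset.sum_congr rfl fun _ _ => by rw [S.Γ_torsion]
  rw [Pi.add_apply, hcurv]
  simp only [Pi.sub_apply, Finset.sum_sub_distrib]
  rw [h1, h2]
  simp only [codiv, cf, dV, df, Finset.sum_apply, Pi.add_apply, Pi.sub_apply, Pi.smul_apply,
    smul_eq_mul, Matrix.mulVec, dotProduct, Matrix.transpose_apply, Finset.sum_add_distrib,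
    Finset.sum_sub_distrib]
  ring

/-! ### The commutator of the two Laplacians -/

/-- The operator `Δ_T f = ∇_a (T^{ab} ∂_b f)`. -/
noncomputable def lap (T : Matrix (Fin n) (Fin n) A) (f : A) : A := S.div (T *ᵥ S.df f)

/-- The matrices `∇^c T^{ab}`, in `a, b`. -/
noncomputable def cu (T : Matrix (Fin n) (Fin n) A) (c : Fin n) : Matrix (Fin n) (Fin n) A :=
  ∑ e, S.G c e • S.ct e T

/-- The contravariant components of `K R - R K`. -/
noncomputable def ricComm (K : Matrix (Fin n) (Fin n) A) : Matrix (Fin n) (Fin n) A :=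
  K * S.ric * S.G - S.G * S.ric * K

theorem cu_apply (T : Matrix (Fin n) (Fin n) A) (c a b : Fin n) :
    S.cu T c a b = ∑ e, S.G c e * S.ct e T a b := by
  simp [cu, Matrix.sum_apply]

theorem cu_symm {K : Matrix (Fin n) (Fin n) A} (hK : Kᵀ = K) (c a b : Fin n) :
    S.cu K c a b = S.cu K c b a := by
  have h : ∀ e, S.ct e K a b = S.ct e K b a := fun e => by
    have := S.ct_transpose e K
    rw [hK] at this
    exact congrFun (congrFun this a) b
  simp only [cu_apply, h]

/-- Up to the Ricci term, the commutator of `Δ` and `Δ_K` is the divergence of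
`Δ(K ∇f) - K Δ∇f = ∇_c (∇^c K^{ab} ∂_b f) + ∇^c K^{ab} ∇_c ∂_b f`, because the gradient of a divergence
and the divergence of a transposed derivative differ by a Ricci term. -/
theorem lap_commutator (K : Matrix (Fin n) (Fin n) A) (f : A) :
    S.lap S.G (S.lap K f) - S.lap K (S.lap S.G f) =
      S.div (S.ricComm K *ᵥ S.df f) + S.div (S.div₂ fun c => S.cu K c *ᵥ S.df f)
        + S.div (∑ c, S.cu K c *ᵥ S.cf c (S.df f)) := by
  set h : Fin n → Fin n → A := fun b => ∑ c, S.G b c • S.cf c (S.df f) with hh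
  have hX : (fun b c => S.cv c (S.G *ᵥ S.df f) b) = h := by
    ext b c
    simp only [hh, cv_mulVec, ct_G, Matrix.zero_mulVec, zero_add, Matrix.mulVec, dotProduct,
      Finset.sum_apply, Pi.smul_apply, smul_eq_mul]
    exact Finset.sum_congr rfl fun e _ => by rw [S.cf_df_symm]
  have hlapX : S.df (S.lap S.G f) = S.codiv h - S.ric *ᵥ (S.G *ᵥ S.df f) := by
    rw [← hX, codiv_cv, lap]; abel
  have hlapW : S.df (S.lap K f) = S.codiv (fun b c => S.cv c (K *ᵥ S.df f) b)
      - S.ric *ᵥ (K *ᵥ S.df f) := by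
    rw [codiv_cv, lap]; abel
  have hT : (fun a b => (S.G *ᵥ (fun c => S.cv c (K *ᵥ S.df f) b)) a)
      = (fun b => S.cu K b *ᵥ S.df f) + fun b => K *ᵥ h b := by
    ext b a
    simp only [Matrix.mulVec_sum, hh, Matrix.mulVec_smul, Pi.add_apply, cu, Matrix.sum_mulVec,
      Matrix.smul_mulVec, Finset.sum_apply, Pi.smul_apply, smul_eq_mul, ← Finset.sum_add_distrib,
      ← mul_add]
    rw [Matrix.mulVec, dotProduct]
    simp only [cv_mulVec, Pi.add_apply]
  -- The double divergence of `∇^a W^b`, for `W = K ∇f`, is that of the transposed tensor.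
  have h1 : S.lap S.G (S.lap K f) = S.div (S.div₂ fun c => S.cu K c *ᵥ S.df f)
      + S.div (∑ b, S.ct b K *ᵥ h b) + S.div (K *ᵥ S.codiv h)
      - S.div ((S.G * S.ric * K) *ᵥ S.df f) := by
    rw [lap, hlapW, Matrix.mulVec_sub, div_sub, ← div₂_G_mulVec, div_div₂_transpose, hT, div₂_add,
      div_add, div₂_mulVec_const, div_add]
    simp only [Matrix.mulVec_mulVec, ← mul_assoc]
    ring
  have h2 : S.lap K (S.lap S.G f) = S.div (K *ᵥ S.codiv h)
      - S.div ((K * S.ric * S.G) *ᵥ S.df f) := by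
    rw [lap, hlapX, Matrix.mulVec_sub, div_sub]
    simp only [Matrix.mulVec_mulVec, ← mul_assoc]
  have h3 : ∑ b, S.ct b K *ᵥ h b = ∑ c, S.cu K c *ᵥ S.cf c (S.df f) := by
    simp only [hh, cu, Matrix.mulVec_sum, Matrix.sum_mulVec, Matrix.mulVec_smul,
      Matrix.smul_mulVec]
    rw [Finset.sum_comm]
    exact Finset.sum_congr rfl fun _ _ => Finset.sum_congr rfl fun _ _ => by
      rw [S.G_symm_apply]
  rw [h1, h2, h3, ricComm, Matrix.sub_mulVec, div_sub]
  ring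

/-! ### Killing tensors -/

/-- The Killing equation `∇^{(a} K^{bc)} = 0`. -/
def IsKilling (K : Matrix (Fin n) (Fin n) A) : Prop :=
  ∀ a b c, S.cu K a b c + S.cu K b c a + S.cu K c a b = 0

theorem div₂_apply (T : Matrix (Fin n) (Fin n) A) (c : Fin n) :
    S.div₂ T c = ∑ b, S.ct b T b c := by
  simp only [div₂, cv, ct, dV, dM_apply, Finset.sum_apply, Pi.add_apply, Matrix.add_apply,
    Pi.smul_apply, smul_eq_mul, Matrix.mulVec, dotProduct, Matrix.mul_apply,
    Matrix.transpose_apply, Finset.sum_add_distrib, γ, Matrix.trace, Matrix.diag_apply,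
    Finset.sum_mul]
  rw [add_right_comm]
  congr 1
  · congr 1
    rw [Finset.sum_comm]
    exact Finset.sum_congr rfl fun _ _ => Finset.sum_congr rfl fun _ _ => by rw [S.Γ_torsion]
  · exact Finset.sum_congr rfl fun _ _ => Finset.sum_congr rfl fun _ _ => mul_comm _ _

/-- The divergence of a Killing tensor is minus half the gradient of its trace. -/
theorem IsKilling.div₂_eq {K : Matrix (Fin n) (Fin n) A} (h : S.IsKilling K) (hK : Kᵀ = K) :
    S.div₂ K + S.div₂ K = -(S.G *ᵥ S.df (S.g * K).trace) := by
  ext c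
  have h1 : ∑ a, ∑ b, S.g a b * S.cu K a b c = S.div₂ K c := by
    rw [div₂_apply, Finset.sum_comm]
    refine Finset.sum_congr rfl fun b _ => ?_
    calc ∑ a, S.g a b * S.cu K a b c
        = ∑ e, (S.g * S.G) b e * S.ct e K b c := by
          simp only [cu_apply, Matrix.mul_apply, Finset.mul_sum, Finset.sum_mul]
          rw [Finset.sum_comm]
          exact Finset.sum_congr rfl fun _ _ => Finset.sum_congr rfl fun _ _ => by
            rw [S.g_symm_apply b]; ring
      _ = S.ct b K b c := by simp [S.g_mul_G, Matrix.one_apply]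
  have h2 : ∑ a, ∑ b, S.g a b * S.cu K b c a = S.div₂ K c := by
    rw [← h1, Finset.sum_comm]
    exact Finset.sum_congr rfl fun _ _ => Finset.sum_congr rfl fun _ _ => by
      rw [S.g_symm_apply, S.cu_symm hK]
  have h3 : ∑ a, ∑ b, S.g a b * S.cu K c a b = (S.G *ᵥ S.df (S.g * K).trace) c := by
    have ht : ∀ e, S.df (S.g * K).trace e = (S.g * S.ct e K).trace := fun e => by
      have e1 : S.df (S.g * K).trace e = (S.dM e (S.g * K)).trace := by
        simp [df, Matrix.trace, dM]
      rw [e1, dM_mul, dM_g, ct, mul_add, mul_add, add_mul, Matrix.trace_add, Matrix.trace_add,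
        Matrix.trace_add, Matrix.trace_add, ← mul_assoc, ← mul_assoc,
        Matrix.trace_mul_comm (S.g * K), mul_assoc (S.Γ e)ᵀ]
      ring
    simp only [Matrix.mulVec, dotProduct, ht]
    simp only [Matrix.trace, Matrix.diag_apply, Matrix.mul_apply, cu_apply, Finset.mul_sum]
    rw [Finset.sum_congr rfl fun a _ => Finset.sum_comm, Finset.sum_comm]
    refine Finset.sum_congr rfl fun e _ => ?_
    refine Finset.sum_congr rfl fun a _ => Finset.sum_congr rfl fun b _ => ?_
    have hs : S.ct e K a b = S.ct e K b a := by
      have := S.ct_transpose e K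
      rw [hK] at this
      exact congrFun (congrFun this a) b
    rw [hs]; ring
  have h4 : ∑ a, ∑ b, S.g a b * (S.cu K a b c + S.cu K b c a + S.cu K c a b) = 0 := by
    simp [h _ _ _]
  simp only [mul_add, Finset.sum_add_distrib, h1, h2, h3] at h4
  simp only [Pi.add_apply, Pi.neg_apply]
  exact eq_neg_of_add_eq_zero_left h4

/-- The contraction `K^{be} R_{fbde}` of the curvature with a symmetric tensor is symmetric. -/
theorem curv_contraction_symm {K : Matrix (Fin n) (Fin n) A} (hK : Kᵀ = K) :
    (Matrix.of fun e f => ∑ b, ∑ c, K b c * (S.g * S.F b e) f c)ᵀ =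
      Matrix.of fun e f => ∑ b, ∑ c, K b c * (S.g * S.F b e) f c := by
  ext e f
  simp only [Matrix.transpose_apply, Matrix.of_apply]
  rw [Finset.sum_comm]
  refine Finset.sum_congr rfl fun c _ => Finset.sum_congr rfl fun b _ => ?_
  rw [S.pair_symm e c b f, S.g_mul_F_swap, show K b c = K c b from congrFun (congrFun hK c) b]

/-- The tensor `∇_b ∇^a K^{bc}` in terms of the divergence of `K` and the curvature. -/
theorem div₃_cu (K : Matrix (Fin n) (Fin n) A) :
    S.div₃ (fun b => Matrix.of fun a c => S.cu K a b c) =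
      S.G * (Matrix.of fun e => S.cv e (S.div₂ K)) + S.G * S.ric * K
        + S.G * (Matrix.of fun e f => ∑ b, ∑ c, K b c * (S.g * S.F b e) f c) * S.G := by
  set Z : Fin n → Matrix (Fin n) (Fin n) A := fun b => Matrix.of fun e c => S.ct e K b c with hZ
  have hN : (fun b => Matrix.of fun a c => S.cu K a b c) = fun b => S.G * Z b := by
    ext b a c
    simp [hZ, cu_apply, Matrix.mul_apply]
  have h1 : S.div₃ (fun b => S.G * Z b) =
      S.G * ∑ b, (S.dM b (Z b) - (S.Γ b)ᵀ * Z b + Z b * (S.Γ b)ᵀ + S.γ b • Z b) := by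
    rw [div₃, Finset.mul_sum]
    refine Finset.sum_congr rfl fun b _ => ?_
    rw [ct, dM_mul, dM_G, mul_add, Matrix.mul_smul]
    congr 1
    noncomm_ring
  have h2 : ∑ b, (S.dM b (Z b) - (S.Γ b)ᵀ * Z b + Z b * (S.Γ b)ᵀ + S.γ b • Z b) =
      (Matrix.of fun e => S.cv e (S.div₂ K)) + S.ric * K
        + (Matrix.of fun e f => ∑ b, ∑ c, K b c * (S.g * S.F b e) f c) * S.G := by
    ext e c
    have e1 : ∑ b, S.ct b (S.ct e K) b c =
        ∑ b, (S.d b (Z b e c) + (Z b * (S.Γ b)ᵀ) e c + S.γ b * Z b e c) := by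
      rw [← div₂_apply]
      simp only [div₂, cv, dV, hZ, Finset.sum_apply, Pi.add_apply, Pi.smul_apply, smul_eq_mul,
        Matrix.mulVec, dotProduct, Matrix.mul_apply, Matrix.transpose_apply, Matrix.of_apply]
      exact Finset.sum_congr rfl fun b _ => by
        simp only [mul_comm]
    have e2 : ∑ b, S.ct e (S.ct b K) b c =
        S.cv e (S.div₂ K) c + ∑ b, ((S.Γ b)ᵀ * Z b) e c := by
      have hct : ∀ b, S.ct e (S.ct b K) b c = S.d e (S.ct b K b c)
          + ∑ f, S.Γ e b f * S.ct b K f c + ∑ f, S.ct b K b f * S.Γ e c f := fun b => rfl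
      have hcv : S.cv e (S.div₂ K) c = S.d e (S.div₂ K c) + ∑ f, S.Γ e c f * S.div₂ K f := rfl
      simp only [hct, hcv, div₂_apply, Finset.sum_add_distrib, map_sum, Finset.mul_sum, hZ,
        Matrix.mul_apply, Matrix.transpose_apply, Matrix.of_apply]
      rw [add_right_comm]
      congr 1
      · congr 1
        rw [Finset.sum_comm]
        exact Finset.sum_congr rfl fun _ _ => Finset.sum_congr rfl fun _ _ => mul_comm _ _
      · rw [Finset.sum_comm]
        exact Finset.sum_congr rfl fun _ _ => Finset.sum_congr rfl fun _ _ => by rw [S.Γ_torsion]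
    have e3 : ∑ b, (S.ct b (S.ct e K) - S.ct e (S.ct b K)) b c = (S.ric * K) e c
        + ((Matrix.of fun e f => ∑ b, ∑ c, K b c * (S.g * S.F b e) f c) * S.G) e c := by
      simp only [ct_ct_sub, Matrix.add_apply, Finset.sum_add_distrib]
      congr 1
      · conv_rhs => rw [← S.ric_symm]
        simp only [Matrix.mul_apply, Matrix.transpose_apply, ric, Matrix.of_apply, Finset.sum_mul]
        exact Finset.sum_comm
      · have hF : ∀ b f, S.F b e c f = ∑ l, S.G c l * (S.g * S.F b e) l f := fun b f => by
          rw [← Matrix.mul_apply, ← mul_assoc, S.G_mul_g, one_mul]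
        have hl : ∀ b, (K * (S.F b e)ᵀ) b c = ∑ f, K b f * S.F b e c f := fun b => rfl
        rw [Matrix.mul_apply]
        simp only [hl, hF, Matrix.of_apply, Finset.mul_sum, Finset.sum_mul]
        rw [Finset.sum_congr rfl fun b _ => Finset.sum_comm, Finset.sum_comm]
        exact Finset.sum_congr rfl fun l _ => Finset.sum_congr rfl fun b _ =>
          Finset.sum_congr rfl fun f _ => by rw [S.G_symm_apply c l]; ring
    simp only [Matrix.sub_apply, Finset.sum_sub_distrib] at e3
    rw [e1, e2] at e3
    simp only [Matrix.sum_apply, Matrix.add_apply, Matrix.sub_apply, Matrix.smul_apply,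
      smul_eq_mul, Matrix.of_apply, dM_apply, Finset.sum_add_distrib, Finset.sum_sub_distrib]
      at e3 ⊢
    linear_combination e3
  rw [hN, h1, h2, mul_add, mul_add, ← mul_assoc, ← mul_assoc]

/-- For a Killing tensor, the antisymmetric part of `∇_b ∇^a K^{bc}` is purely Ricci: the divergence of
`K` is a gradient, and the Riemann term is symmetric. -/
theorem IsKilling.div₃_sub_transpose {K : Matrix (Fin n) (Fin n) A} (h : S.IsKilling K)
    (hK : Kᵀ = K) {M : Matrix (Fin n) (Fin n) A}
    (hM : M = S.div₃ (fun b => Matrix.of fun a c => S.cu K a b c)) :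
    M - Mᵀ = -S.ricComm K := by
  have hsymm : (S.G * Matrix.of fun e => S.cv e (S.div₂ K))ᵀ =
      S.G * Matrix.of fun e => S.cv e (S.div₂ K) := by
    set Y : Matrix (Fin n) (Fin n) A := Matrix.of fun e => S.cv e (S.div₂ K) with hY
    set H : Matrix (Fin n) (Fin n) A := Matrix.of fun e => S.cf e (S.df (S.g * K).trace) with hH
    have hHs : Hᵀ = H := by
      ext a b; exact S.cf_df_symm _ _ _
    have hYH : Y + Y = -(H * S.G) := by
      have hcv : ∀ e, S.cv e (S.div₂ K) + S.cv e (S.div₂ K) =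
          -(S.G *ᵥ S.cf e (S.df (S.g * K).trace)) := fun e => by
        have h0 : ∀ X, S.cv e (-X) = -S.cv e X := fun X => by
          rw [eq_neg_iff_add_eq_zero, ← cv_add, neg_add_cancel]
          ext a; simp [cv, dV]
        rw [← cv_add, h.div₂_eq S hK, h0, cv_mulVec, ct_G, Matrix.zero_mulVec, zero_add]
      ext e c
      have := congrFun (hcv e) c
      simp only [hY, hH, Matrix.add_apply, Matrix.of_apply, Matrix.neg_apply, Matrix.mul_apply,
        Pi.add_apply, Pi.neg_apply, Matrix.mulVec, dotProduct] at this ⊢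
      rw [this]
      congr 1
      exact Finset.sum_congr rfl fun b _ => by rw [S.G_symm_apply b c, mul_comm]
    have h2 : S.G * Y + S.G * Y = -(S.G * H * S.G) := by
      rw [← mul_add, hYH, mul_neg, mul_assoc]
    apply eq_of_add_self_eq
    rw [← Matrix.transpose_add, h2, Matrix.transpose_neg, Matrix.transpose_mul,
      Matrix.transpose_mul, hHs, S.G_symm, mul_assoc]
  rw [hM, div₃_cu, Matrix.transpose_add, Matrix.transpose_add, hsymm, Matrix.transpose_mul _ S.G,
    Matrix.transpose_mul S.G (Matrix.of _), S.curv_contraction_symm hK, Matrix.transpose_mul _ K,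
    Matrix.transpose_mul S.G, S.ric_symm, hK, S.G_symm, ricComm]
  noncomm_ring

/-- The commutator of `Δ` with `Δ_K`, for a Killing tensor `K`, is of first order. In the proof,
`q^a = N^{cab} ∇_c f_b`, `τ^a = N^{abc} ∇_b f_c`, `T₁^{ca} = N^{cab} f_b` and `T₃^{bc} = N^{abc} f_a`; the
five linear relations below determine `∇_a ∇_c T₁^{ca} + ∇_a q^a` from `M - Mᵀ`. -/
theorem IsKilling.lap_commutator {K : Matrix (Fin n) (Fin n) A} (h : S.IsKilling K) (hK : Kᵀ = K)
    (f : A) :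
    3 * (S.lap S.G (S.lap K f) - S.lap K (S.lap S.G f)) =
      2 * S.div (S.ricComm K *ᵥ S.df f) := by
  set N := S.cu K with hN
  set N' : Fin n → Matrix (Fin n) (Fin n) A := fun b => Matrix.of fun a c => N a b c with hN'
  set s := S.df f with hs
  set q := ∑ c, N c *ᵥ S.cf c s with hq
  set τ := ∑ b, N' b *ᵥ S.cf b s with hτ
  set M := S.div₃ N' with hM
  set T₁ : Fin n → Fin n → A := fun c => N c *ᵥ s with hT₁
  set T₃ : Fin n → Fin n → A := fun b => (N' b)ᵀ *ᵥ s with hT₃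
  -- The Killing equation, contracted with `f`.
  have hsum : T₁ + (fun a b => T₁ b a) + T₃ = 0 := by
    ext c a
    simp only [hT₁, hT₃, hN', Pi.add_apply, Matrix.mulVec, dotProduct, Matrix.transpose_apply,
      Matrix.of_apply, ← Finset.sum_add_distrib, ← add_mul, Pi.zero_apply]
    refine Finset.sum_eq_zero fun b _ => ?_
    rw [hN, S.cu_symm hK a c b, ← hN, show N c a b + N a b c + N b c a = 0 by
      linear_combination h c a b, zero_mul]
  have e₁ : 2 * S.div (S.div₂ T₁) = -S.div (S.div₂ T₃) := by
    have h0 := congrArg (fun T => S.div (S.div₂ T)) hsum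
    have hz : S.div (S.div₂ 0) = 0 := by
      have := S.div₂_add 0 0
      rw [add_zero, left_eq_add] at this
      rw [this]; simp [div]
    simp only [div₂_add, div_add, hz, ← S.div_div₂_transpose T₁] at h0
    linear_combination h0
  have e₂ : q + q = -τ := by
    ext a
    have hq1 : q a = ∑ c, ∑ b, N c a b * S.cf c s b := by
      simp [hq, Finset.sum_apply, Matrix.mulVec, dotProduct]
    have hq2 : q a = ∑ c, ∑ b, N b a c * S.cf c s b := by
      rw [hq1, Finset.sum_comm]
      exact Finset.sum_congr rfl fun b _ => Finset.sum_congr rfl fun c _ => by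
        rw [hs, S.cf_df_symm]
    have hτ1 : τ a = ∑ c, ∑ b, N a c b * S.cf c s b := by
      simp [hτ, hN', Finset.sum_apply, Matrix.mulVec, dotProduct]
    rw [Pi.add_apply, Pi.neg_apply, ← add_eq_zero_iff_eq_neg]
    nth_rewrite 1 [hq1]
    rw [hq2, hτ1]
    simp only [← Finset.sum_add_distrib, ← add_mul]
    refine Finset.sum_eq_zero fun c _ => Finset.sum_eq_zero fun b _ => ?_
    rw [hN, S.cu_symm hK b a c, ← hN, show N c a b + N b c a + N a c b = 0 by
      rw [hN, S.cu_symm hK b, S.cu_symm hK a, S.cu_symm hK b, ← hN]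
      linear_combination h c a b, zero_mul]
  -- Both `M` and its transpose arise as derivatives of `N` in its second index.
  have e₃ : S.div (S.div₂ T₁) = S.div (M *ᵥ s) + S.div τ := by
    rw [div_div₂_transpose, ← div_add, ← div₂_mulVec]
    rfl
  have e₄ : S.div (S.div₂ T₃) = S.div (Mᵀ *ᵥ s) + S.div q := by
    have hMt : Mᵀ = S.div₃ fun b => (N' b)ᵀ := by
      simp only [hM, div₃, Matrix.transpose_sum, Matrix.transpose_add, Matrix.transpose_smul,
        ct_transpose]
    have hq3 : q = ∑ b, (N' b)ᵀ *ᵥ S.cf b s := by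
      ext c
      simp only [hq, hN', Finset.sum_apply, Matrix.mulVec, dotProduct, Matrix.transpose_apply,
        Matrix.of_apply]
      rw [Finset.sum_comm]
      exact Finset.sum_congr rfl fun b _ => Finset.sum_congr rfl fun a _ => by
        rw [hs, S.cf_df_symm, hN, S.cu_symm hK]
    rw [hMt, hq3, ← div_add, ← div₂_mulVec]
  have e₅ : S.div (M *ᵥ s) - S.div (Mᵀ *ᵥ s) = -S.div (S.ricComm K *ᵥ s) := by
    rw [← div_sub, ← Matrix.sub_mulVec, h.div₃_sub_transpose S hK hM, Matrix.neg_mulVec, div_neg]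
  have e₆ : 2 * S.div q = -S.div τ := by
    rw [two_mul, ← div_add, e₂, div_neg]
  rw [MetricAlgebra.lap_commutator]
  change 3 * (S.div (S.ricComm K *ᵥ s) + S.div (S.div₂ T₁) + S.div q) =
    2 * S.div (S.ricComm K *ᵥ s)
  linear_combination e₁ + e₃ - e₄ + e₅ + e₆

/-! ### The commutator of the modified operators -/

/-- The operator `-c (Δ_T + E) + V`. -/
noncomputable def op (c : A) (T : Matrix (Fin n) (Fin n) A) (E V f : A) : A :=
  -c * (S.lap T f + E * f) + V * f

/-- The vector field `c (∇E_K - K ∇E) + K ∇V - ∇V_K`. -/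
noncomputable def potentialField (c : A) (K : Matrix (Fin n) (Fin n) A) (E V EK VK : A) :
    Fin n → A :=
  c • (S.G *ᵥ S.df EK - K *ᵥ S.df E) + K *ᵥ S.df V - S.G *ᵥ S.df VK

theorem df_add (x y : A) : S.df (x + y) = S.df x + S.df y := by
  ext a; simp [df]

theorem df_mul (x y : A) : S.df (x * y) = x • S.df y + y • S.df x := by
  ext a; simp [df]

theorem lap_add (T : Matrix (Fin n) (Fin n) A) (x y : A) :
    S.lap T (x + y) = S.lap T x + S.lap T y := by
  rw [lap, df_add, Matrix.mulVec_add, div_add]; rfl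

theorem mulVec_dotProduct_comm {R : Type*} [CommRing R] {T : Matrix (Fin n) (Fin n) R}
    (hT : Tᵀ = T) (v w : Fin n → R) :
    (T *ᵥ v) ⬝ᵥ w = (T *ᵥ w) ⬝ᵥ v := by
  rw [dotProduct_comm, Matrix.dotProduct_mulVec, ← Matrix.mulVec_transpose, hT]

theorem lap_mul {T : Matrix (Fin n) (Fin n) A} (hT : Tᵀ = T) (x y : A) :
    S.lap T (x * y) = x * S.lap T y + y * S.lap T x + 2 * ((T *ᵥ S.df x) ⬝ᵥ S.df y) := by
  have h := mulVec_dotProduct_comm hT (S.df x) (S.df y)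
  rw [lap, df_mul, Matrix.mulVec_add, div_add, Matrix.mulVec_smul, Matrix.mulVec_smul, div_smul,
    div_smul, dotProduct_comm, dotProduct_comm (S.df y), ← h, lap, lap]
  ring

theorem lap_const_mul {c : A} (hc : ∀ a, S.d a c = 0) (T : Matrix (Fin n) (Fin n) A) (x : A) :
    S.lap T (c * x) = c * S.lap T x := by
  have h : S.df c = 0 := funext hc
  rw [lap, df_mul, h, smul_zero, add_zero, Matrix.mulVec_smul, div_smul, h, zero_dotProduct,
    add_zero, lap]

/-- The commutator of the modified operators; the terms with `E`, `V` combine into a vector field and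
its divergence. -/
theorem op_commutator {c : A} (hc : ∀ a, S.d a c = 0) {K : Matrix (Fin n) (Fin n) A} (hK : Kᵀ = K)
    (E V EK VK f : A) :
    S.op c S.G E V (S.op c K EK VK f) - S.op c K EK VK (S.op c S.G E V f) =
      c ^ 2 * (S.lap S.G (S.lap K f) - S.lap K (S.lap S.G f))
        + 2 * c * (S.potentialField c K E V EK VK ⬝ᵥ S.df f)
        + c * f * S.div (S.potentialField c K E V EK VK) := by
  have hn : ∀ a, S.d a (-c) = 0 := fun a => by rw [map_neg, hc, neg_zero]
  have hdiv : S.div (S.potentialField c K E V EK VK) =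
      c * (S.lap S.G EK - S.lap K E) + S.lap K V - S.lap S.G VK := by
    rw [potentialField, div_sub, div_add, div_smul, div_sub, show S.df c = 0 from funext hc,
      zero_dotProduct, add_zero]
    rfl
  rw [hdiv]
  simp only [op, lap_add, S.lap_const_mul hn, S.lap_mul hK, S.lap_mul S.G_symm, potentialField,
    add_dotProduct, sub_dotProduct, smul_dotProduct, smul_eq_mul]
  ring

theorem ricComm_transpose {K : Matrix (Fin n) (Fin n) A} (hK : Kᵀ = K) :
    (S.ricComm K)ᵀ = -S.ricComm K := by
  simp only [ricComm, Matrix.transpose_sub, Matrix.transpose_mul, hK, S.G_symm, S.ric_symm]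
  noncomm_ring

theorem div_div₂_antisymm {C : Matrix (Fin n) (Fin n) A} (hC : Cᵀ = -C) :
    S.div (S.div₂ C) = 0 := by
  have h : S.div (S.div₂ C) = S.div (S.div₂ (Cᵀ : Matrix (Fin n) (Fin n) A)) :=
    S.div_div₂_transpose C
  have hs : S.div (S.div₂ C) + S.div (S.div₂ (Cᵀ : Matrix (Fin n) (Fin n) A)) = 0 := by
    have h0' : C + Cᵀ = 0 := by rw [hC, add_neg_cancel]
    have h0 : (fun a b => C a b) + (fun a b => Cᵀ a b) = 0 := by
      ext a b; exact congrFun (congrFun (h0' : C + Cᵀ = 0) a) b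
    have h1 := S.div₂_add (fun a b => C a b) (fun a b => Cᵀ a b)
    rw [h0] at h1
    refine (S.div_add _ _).symm.trans ((congrArg S.div h1.symm).trans ?_)
    simp [div, div₂, cv, dV]
  rw [← h] at hs
  exact eq_of_add_self_eq (hs.trans (add_zero 0).symm)

theorem d_dotProduct (a : Fin n) (X s : Fin n → A) :
    S.d a (X ⬝ᵥ s) = S.cv a X ⬝ᵥ s + X ⬝ᵥ S.cf a s := by
  rw [cv, cf, add_dotProduct, dotProduct_sub, ← Matrix.vecMul_transpose, ← Matrix.dotProduct_mulVec,
    add_add_sub_cancel]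
  simp only [dotProduct, map_sum, Derivation.leibniz, smul_eq_mul, dV, ← Finset.sum_add_distrib]
  exact Finset.sum_congr rfl fun _ _ => by ring

theorem div_antisymm_mulVec {C : Matrix (Fin n) (Fin n) A} (hC : Cᵀ = -C) (f : A) :
    S.div (C *ᵥ S.df f) = S.div₂ C ⬝ᵥ S.df f := by
  have hCab : ∀ a b, C b a = -C a b := fun a b => congrFun (congrFun hC a) b
  have hz : ∑ a, C a ⬝ᵥ S.cf a (S.df f) = 0 := by
    apply eq_of_add_self_eq
    simp only [dotProduct, add_zero]
    nth_rewrite 2 [Finset.sum_comm]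
    simp only [← Finset.sum_add_distrib]
    refine Finset.sum_eq_zero fun a _ => Finset.sum_eq_zero fun b _ => ?_
    rw [hCab a b, S.cf_df_symm]; ring
  rw [← add_zero (S.div₂ C ⬝ᵥ S.df f), ← hz, div,
    show S.div₂ C = ∑ b, (S.cv b (C b) + S.γ b • C b) from rfl, sum_dotProduct, ← Finset.sum_add_distrib]
  refine Finset.sum_congr rfl fun a _ => ?_
  rw [show (C *ᵥ S.df f) a = C a ⬝ᵥ S.df f from rfl, d_dotProduct, add_dotProduct, smul_dotProduct,
    smul_eq_mul]
  ring

/-- Three times the left side of the vector equation, for `c = ħ²/2`: the coefficient `ħ²/6` of the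
divergence of `C_K` becomes `c`. -/
noncomputable def correction (c : A) (K : Matrix (Fin n) (Fin n) A) (E V EK VK : A) : Fin n → A :=
  c • S.div₂ (S.ricComm K) + (3 : A) • S.potentialField c K E V EK VK

/-- For a Killing tensor, the commutator is of first order, and its coefficients are those of the vector
equation. -/
theorem IsKilling.op_commutator {c : A} (hc : ∀ a, S.d a c = 0) {K : Matrix (Fin n) (Fin n) A}
    (h : S.IsKilling K) (hK : Kᵀ = K) (E V EK VK f : A) :
    3 * (S.op c S.G E V (S.op c K EK VK f) - S.op c K EK VK (S.op c S.G E V f)) =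
      2 * c * (S.correction c K E V EK VK ⬝ᵥ S.df f)
        + c * f * S.div (S.correction c K E V EK VK) := by
  have h3 : S.df (3 : A) = 0 := by
    ext a; exact Derivation.map_natCast (S.d a) 3
  have h1 := h.lap_commutator S hK f
  rw [S.div_antisymm_mulVec (S.ricComm_transpose hK)] at h1
  have h2 : S.div (S.correction c K E V EK VK) = 3 * S.div (S.potentialField c K E V EK VK) := by
    rw [correction, div_add, div_smul, div_smul, S.div_div₂_antisymm (S.ricComm_transpose hK),
      show S.df c = 0 from funext hc, h3, zero_dotProduct, zero_dotProduct]
    ring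
  rw [h2, MetricAlgebra.op_commutator S hc hK, correction, add_dotProduct, smul_dotProduct,
    smul_dotProduct, smul_eq_mul, smul_eq_mul]
  linear_combination c ^ 2 * h1

/-! ### The principal symbol of the commutator -/

/-- On a function that vanishes to third order at a point, the commutator of `Δ` and `Δ_K` is
given by the third derivatives there. -/
theorem eval_lap_commutator (ε : A →ₐ[ℝ] ℝ) (K : Matrix (Fin n) (Fin n) A) (f : A)
    (h₁ : ∀ a, ε (S.d a f) = 0) (h₂ : ∀ a b, ε (S.d a (S.d b f)) = 0) :
    ε (S.lap S.G (S.lap K f) - S.lap K (S.lap S.G f)) =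
      2 * ∑ a, ∑ b, ∑ c, ε (S.cu K a b c) * ε (S.d a (S.d b (S.d c f))) := by
  have e₀ : ε (S.div (S.ricComm K *ᵥ S.df f)) = 0 := by
    simp [div, df, Matrix.mulVec, dotProduct, h₁, h₂]
  have e₁ : ε (S.div (S.div₂ fun c => S.cu K c *ᵥ S.df f)) =
      ∑ a, ∑ b, ∑ c, ε (S.cu K a b c) * ε (S.d a (S.d b (S.d c f))) := by
    simp only [div, div₂, cv, dV, df, Matrix.mulVec, dotProduct, Finset.sum_apply, Pi.add_apply,
      Pi.smul_apply, smul_eq_mul, map_sum, map_add, Derivation.leibniz, map_mul, h₁, h₂, mul_zero,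
      zero_mul, add_zero, Finset.sum_const_zero]
    rw [Finset.sum_comm]
    exact Finset.sum_congr rfl fun a _ => Finset.sum_congr rfl fun b _ =>
      Finset.sum_congr rfl fun c _ => by rw [S.d_comm b a]
  have e₂ : ε (S.div (∑ c, S.cu K c *ᵥ S.cf c (S.df f))) =
      ∑ a, ∑ b, ∑ c, ε (S.cu K a b c) * ε (S.d a (S.d b (S.d c f))) := by
    simp only [div, cf, dV, df, Matrix.mulVec, dotProduct, Finset.sum_apply, Pi.sub_apply,
      Matrix.transpose_apply, smul_eq_mul, map_sum, map_add, map_sub, Derivation.leibniz, map_mul,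
      h₁, h₂, mul_zero, zero_mul, sub_zero, add_zero, Finset.sum_const_zero]
    rw [Finset.sum_comm]
    exact Finset.sum_congr rfl fun a _ => Finset.sum_congr rfl fun b _ =>
      Finset.sum_congr rfl fun c _ => by rw [S.d_comm b a]
  rw [lap_commutator, map_add, map_add, e₀, e₁, e₂]
  ring

/-- The commutator on a product of three functions that vanish at a point, and whose differentials
there are `dx^i`, `dx^j`, `dx^k`: a multiple of the symmetric part of `∇^c K^{ab}`. -/
theorem eval_op_commutator_mul (ε : A →ₐ[ℝ] ℝ) {c : A} (hc : ∀ a, S.d a c = 0)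
    {K : Matrix (Fin n) (Fin n) A} (hK : Kᵀ = K) (E V EK VK : A) (p q r : A) (i j k : Fin n)
    (hp : ε p = 0) (hq : ε q = 0) (hr : ε r = 0)
    (hdp : ∀ a, ε (S.d a p) = if a = i then 1 else 0)
    (hdq : ∀ a, ε (S.d a q) = if a = j then 1 else 0)
    (hdr : ∀ a, ε (S.d a r) = if a = k then 1 else 0) :
    ε (S.op c S.G E V (S.op c K EK VK (p * q * r)) - S.op c K EK VK (S.op c S.G E V (p * q * r))) =
      4 * ε c ^ 2 * ε (S.cu K i j k + S.cu K j k i + S.cu K k i j) := by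
  have h₁ : ∀ a, ε (S.d a (p * q * r)) = 0 := fun a => by
    simp [hp, hq, hr]
  have h₂ : ∀ a b, ε (S.d a (S.d b (p * q * r))) = 0 := fun a b => by
    simp [hp, hq, hr]
  have h₃ : ∀ a b l, ε (S.d a (S.d b (S.d l (p * q * r)))) = 
    (if a = i then 1 else 0) * (if b = j then 1 else 0) * (if l = k then 1 else 0)
    + (if a = i then 1 else 0) * (if b = k then 1 else 0) * (if l = j then 1 else 0)
    + (if a = j then 1 else 0) * (if b = i then 1 else 0) * (if l = k then 1 else 0)
    + (if a = j then 1 else 0) * (if b = k then 1 else 0) * (if l = i then 1 else 0)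
    + (if a = k then 1 else 0) * (if b = i then 1 else 0) * (if l = j then 1 else 0)
    + (if a = k then 1 else 0) * (if b = j then 1 else 0) * (if l = i then 1 else 0) :=
    fun a b l => by
    simp only [Derivation.leibniz, smul_eq_mul, map_add, map_mul, hp, hq, hr, zero_mul, mul_zero,
      add_zero, zero_add, hdp, hdq, hdr]
    ring
  have h₀ : ε (p * q * r) = 0 := by simp [hp]
  have hdot : ε (S.potentialField c K E V EK VK ⬝ᵥ S.df (p * q * r)) = 0 := by
    simp only [dotProduct, df, map_sum, map_mul, h₁, mul_zero, Finset.sum_const_zero]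
  rw [MetricAlgebra.op_commutator S hc hK, map_add, map_add, map_mul, map_pow,
    S.eval_lap_commutator ε K _ h₁ h₂, map_mul, hdot, map_mul _ (c * _), map_mul _ c, h₀]
  simp only [h₃, mul_add, Finset.sum_add_distrib, mul_ite, mul_one, mul_zero, Finset.sum_ite_eq',
    Finset.mem_univ, if_true, map_add]
  rw [S.cu_symm hK i k j, S.cu_symm hK j i k, S.cu_symm hK k j i]
  ring

/-! ### Change of coordinates -/

theorem two_mul_γ (c : Fin n) : 2 * S.γ c = (S.G * S.dM c S.g).trace := by
  have h : S.G * ((S.Γ c)ᵀ * S.g) = S.G * (S.Γ c)ᵀ * S.g := (mul_assoc _ _ _).symm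
  rw [dM_g, mul_add, Matrix.trace_add, ← mul_assoc S.G S.g, S.G_mul_g, one_mul, h,
    Matrix.trace_mul_comm, ← mul_assoc, S.g_mul_G, one_mul, Matrix.trace_transpose, γ, two_mul]

/-- The operator `Δ_K` does not depend on the coordinates: `θ` is the pullback of functions along a
change of coordinates with Jacobian matrix `J`. -/
theorem lap_pullback {B : Type*} [CommRing B] [Algebra ℝ B] (S' : MetricAlgebra n B)
    (θ : B →ₐ[ℝ] A) (J : Matrix (Fin n) (Fin n) A)
    (hJ : ∀ a c e, S.d a (J e c) = S.d c (J e a))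
    (hθ : ∀ c x, S.d c (θ x) = ∑ e, J e c * θ (S'.d e x))
    (hg : S.g = Jᵀ * S'.g.map θ * J)
    {K : Matrix (Fin n) (Fin n) A} {K' : Matrix (Fin n) (Fin n) B}
    (hK : K'.map θ = J * K * Jᵀ) (f : B) :
    S.lap K (θ f) = θ (S'.lap K' f) := by
  set L := S.G * Jᵀ * S'.g.map θ with hL
  have hLJ : L * J = 1 := by
    rw [hL, mul_assoc, mul_assoc, ← mul_assoc Jᵀ, ← hg, S.G_mul_g]
  have hJL : J * L = 1 := mul_eq_one_comm.mp hLJ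
  have hg' : S'.g.map θ * S'.G.map θ = 1 := by
    have := S'.g_mul_G
    rw [← Matrix.map_mul (f := θ), this]; simp
  have hG' : J * S.G * Jᵀ = S'.G.map θ := by
    calc J * S.G * Jᵀ = (J * L) * S'.G.map θ := by
          rw [hL]; simp only [mul_assoc, hg', mul_one]
      _ = _ := by rw [hJL, one_mul]
  -- The field `K ∇f` in the two coordinate systems.
  set X := K *ᵥ S.df (θ f) with hX
  set X' := K' *ᵥ S'.df f with hX'
  have hXX' : ∀ e, θ (X' e) = (J *ᵥ X) e := by
    have h1 : S.df (θ f) = Jᵀ *ᵥ fun e => θ (S'.df f e) := by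
      ext c; exact hθ c f
    have h2 : (fun e => θ (X' e)) = K'.map θ *ᵥ fun e => θ (S'.df f e) := by
      ext e; simp [hX', Matrix.mulVec, dotProduct]
    rw [hK] at h2
    intro e
    rw [hX, h1, Matrix.mulVec_mulVec, Matrix.mulVec_mulVec]
    exact congrFun h2 e
  have hγ : ∀ c, S.γ c = (L * S.dM c J).trace + ∑ e, J e c * θ (S'.γ e) := by
    intro c
    apply eq_of_add_self_eq
    have hd : S.dM c (S'.g.map θ) = ∑ e, J e c • (S'.dM e S'.g).map θ := by
      ext a b
      simp only [dM_apply, Matrix.map_apply, hθ, Matrix.sum_apply, Matrix.smul_apply, smul_eq_mul]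
    have h1 : (S.G * ((S.dM c J)ᵀ * S'.g.map θ * J)).trace = (L * S.dM c J).trace := by
      rw [← Matrix.trace_transpose]
      have hs : (S'.g.map θ)ᵀ = S'.g.map θ := by
        rw [← Matrix.transpose_map, S'.g_symm]
      rw [Matrix.transpose_mul, Matrix.transpose_mul, Matrix.transpose_mul, hs, S.G_symm,
        Matrix.transpose_transpose, Matrix.trace_mul_comm, hL]
      simp only [mul_assoc]
    have h2 : ∀ Y : Matrix (Fin n) (Fin n) B, (S.G * (Jᵀ * Y.map θ * J)).trace =
        θ ((S'.G * Y).trace) := fun Y => by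
      rw [← mul_assoc, Matrix.trace_mul_comm, ← mul_assoc, ← mul_assoc, hG',
        ← Matrix.map_mul (f := θ)]
      simp only [Matrix.trace, Matrix.diag_apply, Matrix.map_apply, map_sum]
    have h3 : ∑ e, J e c * θ (S'.γ e) + ∑ e, J e c * θ (S'.γ e) =
        (S.G * (Jᵀ * S.dM c (S'.g.map θ) * J)).trace := by
      rw [hd, Matrix.mul_sum, Matrix.sum_mul, Matrix.mul_sum, Matrix.trace_sum,
        ← Finset.sum_add_distrib]
      refine Finset.sum_congr rfl fun e _ => ?_
      rw [Matrix.mul_smul, Matrix.smul_mul, Matrix.mul_smul, Matrix.trace_smul, h2, ← two_mul_γ,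
        smul_eq_mul, two_mul, map_add, mul_add]
    have h4 : L * S.dM c J = S.G * (Jᵀ * S'.g.map θ * S.dM c J) := by
      rw [hL]; simp only [mul_assoc]
    have h5 := S.two_mul_γ c
    rw [hg] at h5
    rw [dM_mul, dM_mul, dM_transpose, add_mul, mul_add, mul_add, Matrix.trace_add,
      Matrix.trace_add, h1, ← h3, ← h4] at h5
    linear_combination h5
  -- The matrices of partial derivatives of the field; their traces enter the divergences.
  set D : Matrix (Fin n) (Fin n) A := Matrix.of fun a c => S.d c (X a) with hD
  set D' : Matrix (Fin n) (Fin n) A := Matrix.of fun e b => θ (S'.d b (X' e)) with hD'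
  set Q : Matrix (Fin n) (Fin n) A := Matrix.of fun e c => ∑ a, S.d c (J e a) * X a with hQ
  have hDJ : D' * J = Q + J * D := by
    ext e c
    have h := congrArg (S.d c) (hXX' e)
    rw [hθ] at h
    simp only [Matrix.mulVec, dotProduct, map_sum, Derivation.leibniz, smul_eq_mul] at h
    simp only [hD, hD', hQ, Matrix.mul_apply, Matrix.add_apply, Matrix.of_apply,
      ← Finset.sum_add_distrib]
    rw [Finset.sum_congr rfl fun b _ => mul_comm _ _, h]
    exact Finset.sum_congr rfl fun a _ => by ring
  have hDt : D'.trace = (L * Q).trace + D.trace := by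
    calc D'.trace = ((D' * J) * L).trace := by rw [mul_assoc, hJL, mul_one]
      _ = _ := by
        rw [hDJ, Matrix.trace_mul_comm, mul_add, Matrix.trace_add, ← mul_assoc, hLJ, one_mul]
  have hLQ : (L * Q).trace = ∑ a, (L * S.dM a J).trace * X a := by
    simp only [hQ, Matrix.trace, Matrix.diag_apply, Matrix.mul_apply, Matrix.of_apply, dM_apply,
      Finset.mul_sum, Finset.sum_mul]
    rw [Finset.sum_congr rfl fun c _ => Finset.sum_comm, Finset.sum_comm]
    exact Finset.sum_congr rfl fun a _ => Finset.sum_congr rfl fun c _ =>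
      Finset.sum_congr rfl fun e _ => by rw [hJ c a e]; ring
  have hγX : ∑ a, S.γ a * X a =
      ∑ a, (L * S.dM a J).trace * X a + ∑ e, θ (S'.γ e) * θ (X' e) := by
    simp only [hγ, hXX', add_mul, Finset.sum_add_distrib, Matrix.mulVec, dotProduct,
      Finset.sum_mul, Finset.mul_sum]
    congr 1
    rw [Finset.sum_comm]
    exact Finset.sum_congr rfl fun _ _ => Finset.sum_congr rfl fun _ _ => by ring
  rw [lap, lap, ← hX, ← hX', div, div, map_sum, Finset.sum_add_distrib, hγX]
  simp only [map_add, map_mul, Finset.sum_add_distrib]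
  have e1 : ∑ a, S.d a (X a) = D.trace := rfl
  have e2 : ∑ a, θ (S'.d a (X' a)) = D'.trace := rfl
  rw [e1, e2, hDt, hLQ]
  ring

end MetricAlgebra

open TopologicalSpace (Opens)

/-! ### The ring of smooth functions on an open subset of Euclidean space -/

/-- The algebra of the functions on the open set `U` that are restrictions of functions on `ℝⁿ`
which are smooth on `U`. -/
def smoothAlgebra {n : ℕ} (U : Opens (EuclideanSpace ℝ (Fin n))) : Subalgebra ℝ (U → ℝ) where
  carrier := {x | ∃ F : EuclideanSpace ℝ (Fin n) → ℝ, ContDiffOn ℝ ∞ F U ∧ ∀ y : U, F y = x y}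
  mul_mem' := by
    rintro x x' ⟨F, hF, h⟩ ⟨F', hF', h'⟩
    exact ⟨fun y => F y * F' y, hF.mul hF', fun y => by simp [h, h']⟩
  add_mem' := by
    rintro x x' ⟨F, hF, h⟩ ⟨F', hF', h'⟩
    exact ⟨fun y => F y + F' y, hF.add hF', fun y => by simp [h, h']⟩
  algebraMap_mem' r := ⟨fun _ => r, contDiffOn_const, fun _ => rfl⟩

namespace smoothAlgebra

variable {n : ℕ} {U : Opens (EuclideanSpace ℝ (Fin n))}

/-- A function on `ℝⁿ` represents an element of the algebra if they agree on `U`. -/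
def Rep (F : EuclideanSpace ℝ (Fin n) → ℝ) (x : smoothAlgebra U) : Prop := ∀ y : U, F y = x.1 y

/-- Evaluation at a point of `U`. -/
def eval (y : U) : smoothAlgebra U →ₐ[ℝ] ℝ := (Pi.evalAlgHom ℝ _ y).comp (smoothAlgebra U).val

/-- The element of the algebra given by a function that is smooth on `U`. -/
def res (F : EuclideanSpace ℝ (Fin n) → ℝ) (hF : ContDiffOn ℝ ∞ F U) : smoothAlgebra U :=
  ⟨fun y => F y, F, hF, fun _ => rfl⟩

theorem rep_res (F : EuclideanSpace ℝ (Fin n) → ℝ) (hF : ContDiffOn ℝ ∞ F U) : Rep F (res F hF) :=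
  fun _ => rfl

theorem ext_eval {x x' : smoothAlgebra U} (h : ∀ y, eval y x = eval y x') : x = x' :=
  Subtype.ext (funext h)

theorem Rep.contDiffOn {F : EuclideanSpace ℝ (Fin n) → ℝ} {x : smoothAlgebra U} (h : Rep F x) :
    ContDiffOn ℝ ∞ F U := by
  obtain ⟨F', hF', h'⟩ := x.2
  exact hF'.congr fun y hy => (h ⟨y, hy⟩).trans (h' ⟨y, hy⟩).symm

theorem exists_rep (x : smoothAlgebra U) : ∃ F, ContDiffOn ℝ ∞ F U ∧ Rep F x := x.2

theorem partialDeriv_contDiffOn (a : Fin n) {F : EuclideanSpace ℝ (Fin n) → ℝ}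
    (hF : ContDiffOn ℝ ∞ F U) : ContDiffOn ℝ ∞ (Coord.partialDeriv a F) U :=
  (hF.fderiv_of_isOpen U.isOpen (by simp)).clm_apply contDiffOn_const

theorem partialDeriv_congr (a : Fin n) {F F' : EuclideanSpace ℝ (Fin n) → ℝ}
    (h : ∀ y ∈ U, F y = F' y) {y : EuclideanSpace ℝ (Fin n)} (hy : y ∈ U) :
    Coord.partialDeriv a F y = Coord.partialDeriv a F' y := by
  have : F =ᶠ[nhds y] F' := Filter.eventuallyEq_of_mem (U.isOpen.mem_nhds hy) h
  rw [Coord.partialDeriv, Coord.partialDeriv, this.fderiv_eq]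

theorem contDiffAt_of_mem {F : EuclideanSpace ℝ (Fin n) → ℝ} (hF : ContDiffOn ℝ ∞ F U) (y : U) :
    ContDiffAt ℝ ∞ F y := hF.contDiffAt (U.isOpen.mem_nhds y.2)

theorem differentiableAt_of_mem {F : EuclideanSpace ℝ (Fin n) → ℝ} (hF : ContDiffOn ℝ ∞ F U)
    (y : U) : DifferentiableAt ℝ F y := (contDiffAt_of_mem hF y).differentiableAt (by simp)

/-- The partial derivative, as an operation on the algebra. -/
noncomputable def pderiv (a : Fin n) (x : smoothAlgebra U) : smoothAlgebra U :=
  res (Coord.partialDeriv a (exists_rep x).choose)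
    (partialDeriv_contDiffOn a (exists_rep x).choose_spec.1)

theorem Rep.pderiv {F : EuclideanSpace ℝ (Fin n) → ℝ} {x : smoothAlgebra U} (h : Rep F x)
    (a : Fin n) : Rep (Coord.partialDeriv a F) (pderiv a x) := fun y =>
  partialDeriv_congr a (fun z hz => (h ⟨z, hz⟩).trans ((exists_rep x).choose_spec.2 ⟨z, hz⟩).symm) y.2

theorem Rep.eq {F : EuclideanSpace ℝ (Fin n) → ℝ} {x : smoothAlgebra U} (h : Rep F x) (y : U) :
    F y = eval y x := h y

/-- The partial derivative, as a derivation. -/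
noncomputable def d (a : Fin n) : Derivation ℝ (smoothAlgebra U) (smoothAlgebra U) :=
  Derivation.mk'
    { toFun := pderiv a
      map_add' := fun x x' => by
        obtain ⟨F, hF, h⟩ := exists_rep x
        obtain ⟨F', hF', h'⟩ := exists_rep x'
        have hs : Rep (fun y => F y + F' y) (x + x') := fun y => congrArg₂ (· + ·) (h y) (h' y)
        refine ext_eval fun y => ?_
        rw [map_add, ← (hs.pderiv a).eq, ← (h.pderiv a).eq, ← (h'.pderiv a).eq, Coord.partialDeriv,
          fderiv_fun_add (differentiableAt_of_mem hF y) (differentiableAt_of_mem hF' y)]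
        rfl
      map_smul' := fun r x => by
        obtain ⟨F, hF, h⟩ := exists_rep x
        have hs : Rep (fun y => r * F y) (r • x) := fun y => congrArg (r * ·) (h y)
        refine ext_eval fun y => ?_
        rw [RingHom.id_apply, map_smul, ← (hs.pderiv a).eq, ← (h.pderiv a).eq, Coord.partialDeriv,
          fderiv_const_mul (differentiableAt_of_mem hF y)]
        rfl }
    fun x x' => by
      obtain ⟨F, hF, h⟩ := exists_rep x
      obtain ⟨F', hF', h'⟩ := exists_rep x'
      have hs : Rep (fun y => F y * F' y) (x * x') := fun y => congrArg₂ (· * ·) (h y) (h' y)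
      refine ext_eval fun y => ?_
      change eval y (pderiv a (x * x')) = eval y (x * pderiv a x' + x' * pderiv a x)
      rw [map_add, map_mul, map_mul, ← (hs.pderiv a).eq, ← (h.pderiv a).eq, ← (h'.pderiv a).eq,
        ← h.eq, ← h'.eq, Coord.partialDeriv,
        fderiv_fun_mul (differentiableAt_of_mem hF y) (differentiableAt_of_mem hF' y)]
      rfl

theorem Rep.d {F : EuclideanSpace ℝ (Fin n) → ℝ} {x : smoothAlgebra U} (h : Rep F x) (a : Fin n) :
    Rep (Coord.partialDeriv a F) (d a x) := h.pderiv a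

theorem d_comm (i j : Fin n) (x : smoothAlgebra U) : d i (d j x) = d j (d i x) := by
  obtain ⟨F, hF, h⟩ := exists_rep x
  refine ext_eval fun y => ?_
  have key : ∀ i j : Fin n, Coord.partialDeriv i (Coord.partialDeriv j F) y =
      fderiv ℝ (fderiv ℝ F) y (EuclideanSpace.single i 1) (EuclideanSpace.single j 1) := by
    intro i j
    have hd : DifferentiableAt ℝ (fderiv ℝ F) y :=
      ((contDiffAt_of_mem hF y).fderiv_right (m := 1) (by norm_cast)).differentiableAt (by simp)
    change fderiv ℝ (fun z => fderiv ℝ F z (EuclideanSpace.single j 1)) y _ = _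
    rw [fderiv_clm_apply hd (by fun_prop)]
    simp
  rw [← ((h.d j).d i).eq, ← ((h.d i).d j).eq, key, key]
  exact ((contDiffAt_of_mem hF y).isSymmSndFDerivAt (by simp; norm_cast)).eq _ _

theorem isUnit_of_ne_zero (x : smoothAlgebra U) (hx : ∀ y, eval y x ≠ 0) : IsUnit x := by
  obtain ⟨F, hF, h⟩ := exists_rep x
  have hinv : ContDiffOn ℝ ∞ (fun y => (F y)⁻¹) U :=
    hF.inv fun y hy => (h.eq ⟨y, hy⟩).symm ▸ hx ⟨y, hy⟩
  refine IsUnit.of_mul_eq_one (res _ hinv) (ext_eval fun y => ?_)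
  rw [map_mul, map_one, ← (rep_res _ hinv).eq, ← h.eq]
  exact mul_inv_cancel₀ (h.eq y ▸ hx y)

end smoothAlgebra

/-! ### The differential ring of a metric on an open subset of Euclidean space -/

/-- The matrix-valued function `g` is, on `U`, a smooth family of symmetric invertible matrices. -/
structure IsMetricOn {n : ℕ} (U : Opens (EuclideanSpace ℝ (Fin n)))
    (g : EuclideanSpace ℝ (Fin n) → Matrix (Fin n) (Fin n) ℝ) : Prop where
  smooth (a b : Fin n) : ContDiffOn ℝ ∞ (fun y => g y a b) U
  symm (y : U) : (g y)ᵀ = g y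
  det_ne_zero (y : U) : (g y).det ≠ 0

open smoothAlgebra

/-- The matrix over the algebra of smooth functions that is given by a smooth family of matrices. -/
def resMatrix {n : ℕ} {U : Opens (EuclideanSpace ℝ (Fin n))}
    (K : EuclideanSpace ℝ (Fin n) → Matrix (Fin n) (Fin n) ℝ)
    (hK : ∀ a b, ContDiffOn ℝ ∞ (fun y => K y a b) U) :
    Matrix (Fin n) (Fin n) (smoothAlgebra U) :=
  Matrix.of fun a b => res (fun y => K y a b) (hK a b)

namespace IsMetricOn

variable {n : ℕ} {U : Opens (EuclideanSpace ℝ (Fin n))}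
  {g : EuclideanSpace ℝ (Fin n) → Matrix (Fin n) (Fin n) ℝ}

theorem isUnit_det (hg : IsMetricOn U g) : IsUnit (resMatrix g hg.smooth).det := by
  refine isUnit_of_ne_zero _ fun y => ?_
  have h : (eval y) (resMatrix g hg.smooth).det = (g y).det := by
    rw [AlgHom.map_det]; rfl
  rw [h]
  exact hg.det_ne_zero y

/-- The smooth functions on `U`, with the metric `g`. -/
noncomputable def metricAlgebra (hg : IsMetricOn U g) : MetricAlgebra n (smoothAlgebra U) where
  d := smoothAlgebra.d
  d_comm := smoothAlgebra.d_comm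
  g := resMatrix g hg.smooth
  G := (resMatrix g hg.smooth)⁻¹
  g_symm := Matrix.ext fun a b => ext_eval fun y => congrFun (congrFun (hg.symm y) a) b
  g_mul_G := Matrix.mul_nonsing_inv _ hg.isUnit_det

variable (hg : IsMetricOn U g)

theorem eval_d (a : Fin n) {x : smoothAlgebra U} {F : EuclideanSpace ℝ (Fin n) → ℝ}
    (h : ∀ y, eval y x = F y) (y : U) :
    eval y (hg.metricAlgebra.d a x) = Coord.partialDeriv a F y :=
  (Rep.d (fun y => (h y).symm) a y).symm

theorem eval_g (y : U) (a b : Fin n) : eval y (hg.metricAlgebra.g a b) = g y a b := rfl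

theorem eval_G (y : U) (a b : Fin n) :
    eval y (hg.metricAlgebra.G a b) = Coord.metricInv g y a b := by
  have h := congrArg (fun M => M.map (eval y)) hg.metricAlgebra.g_mul_G
  rw [Matrix.map_mul] at h
  have h1 : (1 : Matrix (Fin n) (Fin n) (smoothAlgebra U)).map (eval y) = 1 := by simp
  rw [h1] at h
  have h2 : (g y)⁻¹ = hg.metricAlgebra.G.map (eval y) := Matrix.inv_eq_right_inv h
  rw [Coord.metricInv, h2]; rfl

theorem eval_Γ (y : U) (a b c : Fin n) :
    eval y (hg.metricAlgebra.Γ c a b) = Coord.christoffel g a c b y := by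
  rw [MetricAlgebra.Γ, Matrix.smul_apply, map_smul, Matrix.mul_apply, map_sum, smul_eq_mul,
    Coord.christoffel]
  refine congrArg _ (Finset.sum_congr rfl fun e _ => ?_)
  rw [map_mul, eval_G, MetricAlgebra.firstKind, Matrix.of_apply, map_sub, map_add,
    hg.eval_d (F := fun z => g z e b) c fun y => hg.eval_g y e b,
    hg.eval_d (F := fun z => g z e c) b fun y => hg.eval_g y e c,
    hg.eval_d (F := fun z => g z c b) e fun y => hg.eval_g y c b]

theorem eval_F (y : U) (a b c e : Fin n) :
    eval y (hg.metricAlgebra.F c e a b) = Coord.riemann g a b c e y := by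
  rw [MetricAlgebra.F, Matrix.add_apply, Matrix.sub_apply, Matrix.sub_apply, Matrix.mul_apply,
    Matrix.mul_apply, MetricAlgebra.dM_apply, MetricAlgebra.dM_apply]
  simp only [map_add, map_sub, map_sum, map_mul, eval_Γ,
    hg.eval_d c fun y => hg.eval_Γ y a b e, hg.eval_d e fun y => hg.eval_Γ y a b c,
    Coord.riemann, Finset.sum_sub_distrib]

theorem eval_ric (y : U) (a b : Fin n) :
    eval y (hg.metricAlgebra.ric a b) = Coord.ricci g y a b := by
  simp only [MetricAlgebra.ric, Matrix.of_apply, map_sum, eval_F, Coord.ricci]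

theorem eval_ct {K : EuclideanSpace ℝ (Fin n) → Matrix (Fin n) (Fin n) ℝ}
    {K' : Matrix (Fin n) (Fin n) (smoothAlgebra U)} (hK : ∀ y a b, eval y (K' a b) = K y a b)
    (y : U) (a b c : Fin n) :
    eval y (hg.metricAlgebra.ct c K' a b) = Coord.covDeriv g K c a b y := by
  rw [MetricAlgebra.ct, Matrix.add_apply, Matrix.add_apply, Matrix.mul_apply, Matrix.mul_apply,
    MetricAlgebra.dM_apply]
  simp only [map_add, map_sum, map_mul, eval_Γ, hK, Matrix.transpose_apply,
    hg.eval_d (F := fun z => K z a b) c fun y => hK y a b, Coord.covDeriv, Finset.sum_add_distrib]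
  simp only [mul_comm (K y a _), add_assoc]

theorem eval_cu {K : EuclideanSpace ℝ (Fin n) → Matrix (Fin n) (Fin n) ℝ}
    {K' : Matrix (Fin n) (Fin n) (smoothAlgebra U)} (hK : ∀ y a b, eval y (K' a b) = K y a b)
    (y : U) (a b c : Fin n) :
    eval y (hg.metricAlgebra.cu K' c a b) = Coord.covDerivUp g K c a b y := by
  simp only [MetricAlgebra.cu_apply, map_sum, map_mul, eval_G, hg.eval_ct hK, Coord.covDerivUp]

theorem eval_div₂ {T : EuclideanSpace ℝ (Fin n) → Matrix (Fin n) (Fin n) ℝ}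
    {T' : Matrix (Fin n) (Fin n) (smoothAlgebra U)} (hT : ∀ y a b, eval y (T' a b) = T y a b)
    (y : U) (a : Fin n) :
    eval y (hg.metricAlgebra.div₂ T' a) = Coord.divTensor g T y a := by
  simp only [MetricAlgebra.div₂_apply, map_sum, hg.eval_ct hT, Coord.divTensor]

theorem eval_ricComm {K : EuclideanSpace ℝ (Fin n) → Matrix (Fin n) (Fin n) ℝ}
    {K' : Matrix (Fin n) (Fin n) (smoothAlgebra U)} (hK : ∀ y a b, eval y (K' a b) = K y a b)
    (y : U) (a b : Fin n) :
    eval y (hg.metricAlgebra.ricComm K' a b) = Coord.ricciCommutator g K y a b := by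
  simp only [MetricAlgebra.ricComm, Coord.ricciCommutator, Matrix.sub_apply, Matrix.mul_apply,
    map_sub, map_sum, map_mul, hK, eval_G, eval_ric]

theorem eval_tensorGrad {K : EuclideanSpace ℝ (Fin n) → Matrix (Fin n) (Fin n) ℝ}
    {K' : Matrix (Fin n) (Fin n) (smoothAlgebra U)} (hK : ∀ y a b, eval y (K' a b) = K y a b)
    {F : EuclideanSpace ℝ (Fin n) → ℝ} {f : smoothAlgebra U} (hf : ∀ y, eval y f = F y)
    (y : U) (a : Fin n) :
    eval y ((K' *ᵥ hg.metricAlgebra.df f) a) = Coord.tensorGrad K F y a := by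
  simp only [Matrix.mulVec, dotProduct, map_sum, map_mul, hK, MetricAlgebra.df, hg.eval_d _ hf,
    Coord.tensorGrad]

theorem eval_grad {F : EuclideanSpace ℝ (Fin n) → ℝ} {f : smoothAlgebra U}
    (hf : ∀ y, eval y f = F y) (y : U) (a : Fin n) :
    eval y ((hg.metricAlgebra.G *ᵥ hg.metricAlgebra.df f) a) = Coord.grad g F y a :=
  hg.eval_tensorGrad (fun y a b => hg.eval_G y a b) hf y a

theorem eval_lap {K : EuclideanSpace ℝ (Fin n) → Matrix (Fin n) (Fin n) ℝ}
    {K' : Matrix (Fin n) (Fin n) (smoothAlgebra U)} (hK : ∀ y a b, eval y (K' a b) = K y a b)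
    {F : EuclideanSpace ℝ (Fin n) → ℝ} {f : smoothAlgebra U} (hf : ∀ y, eval y f = F y) (y : U) :
    eval y (hg.metricAlgebra.lap K' f) = Coord.tensorLaplacian g K F y := by
  rw [MetricAlgebra.lap, MetricAlgebra.div_eq, map_sum]
  simp only [map_add, map_sum, map_mul, hg.eval_tensorGrad hK hf, eval_Γ, Coord.tensorLaplacian,
    Coord.divVector]
  refine Finset.sum_congr rfl fun a _ => ?_
  rw [hg.eval_d (F := fun z => Coord.tensorGrad K F z a) a
    fun y => hg.eval_tensorGrad hK hf y a]

end IsMetricOn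

/-- The operator `Δ_K` in coordinates is invariant under a smooth change of coordinates `T`. -/
theorem tensorLaplacian_comp {n : ℕ} {U U' : Opens (EuclideanSpace ℝ (Fin n))}
    {g K g' K' : EuclideanSpace ℝ (Fin n) → Matrix (Fin n) (Fin n) ℝ}
    (hg : IsMetricOn U g) (hg' : IsMetricOn U' g')
    (hK : ∀ a b, ContDiffOn ℝ ∞ (fun y => K y a b) U)
    (hK' : ∀ a b, ContDiffOn ℝ ∞ (fun y => K' y a b) U')
    {T : EuclideanSpace ℝ (Fin n) → EuclideanSpace ℝ (Fin n)} (hT : ContDiffOn ℝ ∞ T U)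
    (hTU : ∀ y ∈ U, T y ∈ U') {J : EuclideanSpace ℝ (Fin n) → Matrix (Fin n) (Fin n) ℝ}
    (hJ : ∀ y e c, J y e c = fderiv ℝ T y (EuclideanSpace.single c 1) e)
    (hgT : ∀ y ∈ U, g y = (J y)ᵀ * g' (T y) * J y)
    (hKT : ∀ y ∈ U, K' (T y) = J y * K y * (J y)ᵀ)
    {F F' : EuclideanSpace ℝ (Fin n) → ℝ} (hF' : ContDiffOn ℝ ∞ F' U')
    (hF : ∀ y ∈ U, F y = F' (T y)) {y : EuclideanSpace ℝ (Fin n)} (hy : y ∈ U) :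
    Coord.tensorLaplacian g K F y = Coord.tensorLaplacian g' K' F' (T y) := by
  have hTd : ∀ y : U, DifferentiableAt ℝ T y := fun y =>
    (hT.contDiffAt (U.isOpen.mem_nhds y.2)).differentiableAt (by simp)
  have hTe : ∀ e, ContDiffOn ℝ ∞ (fun y => T y e) U := fun e => by
    exact (EuclideanSpace.proj (𝕜 := ℝ) e).contDiff.comp_contDiffOn hT
  have hJe : ∀ (y : U) e c, J y e c = Coord.partialDeriv c (fun y => T y e) y := fun y e c => by
    rw [hJ, Coord.partialDeriv]
    have := ((EuclideanSpace.proj (𝕜 := ℝ) e).hasFDerivAt.comp (y : EuclideanSpace ℝ (Fin n))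
      (hTd y).hasFDerivAt).fderiv
    rw [show (fun y => T y e) = (EuclideanSpace.proj (𝕜 := ℝ) e) ∘ T from rfl, this]
    rfl
  -- Pullback of functions along `T`.
  let θ : smoothAlgebra U' →ₐ[ℝ] smoothAlgebra U :=
    { toFun := fun x => ⟨fun y => x.1 ⟨T y, hTU y y.2⟩, by
        obtain ⟨F, hF, h⟩ := x.2
        exact ⟨F ∘ T, hF.comp hT hTU, fun y => h ⟨T y, hTU y y.2⟩⟩⟩
      map_one' := rfl
      map_mul' := fun _ _ => rfl
      map_zero' := rfl
      map_add' := fun _ _ => rfl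
      commutes' := fun _ => rfl }
  have hθ : ∀ (y : U) x, eval y (θ x) = eval ⟨T y, hTU y y.2⟩ x := fun _ _ => rfl
  let JA : Matrix (Fin n) (Fin n) (smoothAlgebra U) :=
    Matrix.of fun e c => hg.metricAlgebra.d c (res (fun y => T y e) (hTe e))
  have hJA : ∀ (y : U) e c, eval y (JA e c) = J y e c := fun y e c => by
    rw [hJe]
    exact hg.eval_d (F := fun y => T y e) c (fun y => rfl) y
  have hKA : ∀ (y : U) a b, eval y (resMatrix K hK a b) = K y a b := fun _ _ _ => rfl
  have hKA' : ∀ (y : U') a b, eval y (resMatrix K' hK' a b) = K' y a b := fun _ _ _ => rfl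
  have key := hg.metricAlgebra.lap_pullback hg'.metricAlgebra θ JA
    (fun a c e => hg.metricAlgebra.d_comm _ _ _)
    (fun c x => ext_eval fun y => by
      obtain ⟨H, hH, hHx⟩ := exists_rep x
      have h1 : ∀ y : U, eval y (θ x) = (H ∘ T) y := fun y => (hHx ⟨T y, hTU y y.2⟩).symm
      have h2 : ∀ y : U', eval y x = H y := fun y => (hHx y).symm
      rw [hg.eval_d c h1, map_sum]
      simp only [map_mul, hJA, hθ, hg'.eval_d _ h2, hJ]
      have hHd : DifferentiableAt ℝ H (T y) := differentiableAt_of_mem hH ⟨T y, hTU y y.2⟩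
      rw [Coord.partialDeriv, fderiv_comp _ hHd (hTd y), ContinuousLinearMap.comp_apply]
      have hv : ∀ v : EuclideanSpace ℝ (Fin n), v = ∑ e, v e • EuclideanSpace.single e (1 : ℝ) :=
        fun v => by
          ext i; simp [Finset.sum_apply, Pi.single_apply]
      conv_lhs => rw [hv (fderiv ℝ T y (EuclideanSpace.single c 1)), map_sum]
      simp only [map_smul, smul_eq_mul, Coord.partialDeriv])
    (by
      refine Matrix.ext fun a b => ext_eval fun y => ?_
      rw [hg.eval_g, hgT y y.2]
      simp only [Matrix.mul_apply, map_sum, map_mul, Matrix.transpose_apply, hJA, Matrix.map_apply,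
        hθ, hg'.eval_g])
    (K := resMatrix K hK) (K' := resMatrix K' hK')
    (by
      refine Matrix.ext fun a b => ext_eval fun y => ?_
      rw [Matrix.map_apply, hθ, hKA', hKT y y.2]
      simp only [Matrix.mul_apply, map_sum, map_mul, Matrix.transpose_apply, hJA, hKA])
    (res F' hF')
  have h := congrArg (eval ⟨y, hy⟩) key
  rw [hθ, hg'.eval_lap hKA' (F := F') (fun _ => rfl), hg.eval_lap hKA (F := F)
    (fun y => (hF y y.2).symm)] at h
  exact h

/-! ### The commutator in coordinates -/

/-- The operator `-(ħ²/2)(Δ_T + E) + V` in coordinates. -/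
noncomputable def coordOp {n : ℕ} (ħ : ℝ)
    (g T : EuclideanSpace ℝ (Fin n) → Matrix (Fin n) (Fin n) ℝ)
    (E V F : EuclideanSpace ℝ (Fin n) → ℝ) (y : EuclideanSpace ℝ (Fin n)) : ℝ :=
  -(ħ ^ 2 / 2) * (Coord.tensorLaplacian g T F y + E y * F y) + V y * F y

namespace IsMetricOn

variable {n : ℕ} {U : Opens (EuclideanSpace ℝ (Fin n))}
  {g : EuclideanSpace ℝ (Fin n) → Matrix (Fin n) (Fin n) ℝ}

theorem eval_op (hg : IsMetricOn U g) (ħ : ℝ) {T : EuclideanSpace ℝ (Fin n) → Matrix (Fin n) (Fin n) ℝ}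
    {T' : Matrix (Fin n) (Fin n) (smoothAlgebra U)} (hT : ∀ y a b, eval y (T' a b) = T y a b)
    {E V F : EuclideanSpace ℝ (Fin n) → ℝ} {E' V' f : smoothAlgebra U}
    (hE : ∀ y, eval y E' = E y) (hV : ∀ y, eval y V' = V y) (hf : ∀ y, eval y f = F y) (y : U) :
    eval y (hg.metricAlgebra.op (algebraMap ℝ _ (ħ ^ 2 / 2)) T' E' V' f) =
      coordOp ħ g T E V F y := by
  have hc : eval y (algebraMap ℝ (smoothAlgebra U) (ħ ^ 2 / 2)) = ħ ^ 2 / 2 :=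
    AlgHom.commutes _ _
  rw [MetricAlgebra.op, map_add, map_mul, map_mul, map_neg, hc, map_add, map_mul,
    hg.eval_lap hT hf, hE, hV, hf, coordOp]

theorem eval_correction (hg : IsMetricOn U g) (ħ : ℝ) {K : EuclideanSpace ℝ (Fin n) → Matrix (Fin n) (Fin n) ℝ}
    {K' : Matrix (Fin n) (Fin n) (smoothAlgebra U)} (hK : ∀ y a b, eval y (K' a b) = K y a b)
    {E V EK VK : EuclideanSpace ℝ (Fin n) → ℝ} {E' V' EK' VK' : smoothAlgebra U}
    (hE : ∀ y, eval y E' = E y) (hV : ∀ y, eval y V' = V y) (hEK : ∀ y, eval y EK' = EK y)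
    (hVK : ∀ y, eval y VK' = VK y) (y : U) (a : Fin n) :
    eval y (hg.metricAlgebra.correction (algebraMap ℝ _ (ħ ^ 2 / 2)) K' E' V' EK' VK' a) =
      3 * (ħ ^ 2 / 6 * Coord.divTensor g (Coord.ricciCommutator g K) y a
        + ħ ^ 2 / 2 * (Coord.grad g EK y a - Coord.tensorGrad K E y a)
        + Coord.tensorGrad K V y a - Coord.grad g VK y a) := by
  have hc : eval y (algebraMap ℝ (smoothAlgebra U) (ħ ^ 2 / 2)) = ħ ^ 2 / 2 :=
    AlgHom.commutes _ _
  rw [MetricAlgebra.correction, MetricAlgebra.potentialField]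
  simp only [Pi.add_apply, Pi.sub_apply, Pi.smul_apply, smul_eq_mul, map_add, map_sub, map_mul, hc,
    hg.eval_div₂ (hg.eval_ricComm hK), hg.eval_tensorGrad hK hE, hg.eval_tensorGrad hK hV,
    hg.eval_grad hEK, hg.eval_grad hVK, map_ofNat]
  ring

theorem contDiffOn_coordOp (hg : IsMetricOn U g) (ħ : ℝ) {T : EuclideanSpace ℝ (Fin n) → Matrix (Fin n) (Fin n) ℝ}
    (hT : ∀ a b, ContDiffOn ℝ ∞ (fun y => T y a b) U)
    {E V F : EuclideanSpace ℝ (Fin n) → ℝ} (hE : ContDiffOn ℝ ∞ E U) (hV : ContDiffOn ℝ ∞ V U)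
    (hF : ContDiffOn ℝ ∞ F U) : ContDiffOn ℝ ∞ (coordOp ħ g T E V F) U :=
  Rep.contDiffOn (x := hg.metricAlgebra.op (algebraMap ℝ _ (ħ ^ 2 / 2)) (resMatrix T hT) (res E hE)
    (res V hV) (res F hF)) fun y => (hg.eval_op ħ (T' := resMatrix T hT) (fun _ _ _ => rfl)
    (E' := res E hE) (V' := res V hV) (f := res F hF) (fun _ => rfl) (fun _ => rfl)
    (fun _ => rfl) y).symm

theorem contDiffOn_metricInv (hg : IsMetricOn U g) (a b : Fin n) :
    ContDiffOn ℝ ∞ (fun y => Coord.metricInv g y a b) U :=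
  Rep.contDiffOn (x := hg.metricAlgebra.G a b) fun y => (hg.eval_G y a b).symm

/-- The coordinate form of the theorem, for a class of test functions that is closed under products
and contains, at each point, functions with prescribed first derivatives. -/
theorem commute_iff (hg : IsMetricOn U g) {ħ : ℝ} (hħ : ħ ≠ 0)
    {K : EuclideanSpace ℝ (Fin n) → Matrix (Fin n) (Fin n) ℝ}
    (hK : ∀ a b, ContDiffOn ℝ ∞ (fun y => K y a b) U) (hKs : ∀ y : U, (K y)ᵀ = K y)
    {E V EK VK : EuclideanSpace ℝ (Fin n) → ℝ} (hE : ContDiffOn ℝ ∞ E U) (hV : ContDiffOn ℝ ∞ V U)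
    (hEK : ContDiffOn ℝ ∞ EK U) (hVK : ContDiffOn ℝ ∞ VK U)
    (𝓕 : Set (EuclideanSpace ℝ (Fin n) → ℝ)) (h𝓕 : ∀ F ∈ 𝓕, ContDiffOn ℝ ∞ F U)
    (h𝓕mul : ∀ F ∈ 𝓕, ∀ F' ∈ 𝓕, (fun y => F y * F' y) ∈ 𝓕)
    (h𝓕d : ∀ y ∈ U, ∀ i, ∃ F ∈ 𝓕, F y = 0 ∧ ∀ a, Coord.partialDeriv a F y = if a = i then 1 else 0) :
    (∀ F ∈ 𝓕, ∀ y ∈ U, coordOp ħ g (Coord.metricInv g) E V (coordOp ħ g K EK VK F) y =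
        coordOp ħ g K EK VK (coordOp ħ g (Coord.metricInv g) E V F) y) ↔
      (∀ y ∈ U, ∀ a b c, Coord.covDerivUp g K a b c y + Coord.covDerivUp g K b c a y
        + Coord.covDerivUp g K c a b y = 0) ∧
      ∀ y ∈ U, ∀ a, ħ ^ 2 / 6 * Coord.divTensor g (Coord.ricciCommutator g K) y a
        + ħ ^ 2 / 2 * (Coord.grad g EK y a - Coord.tensorGrad K E y a)
        + Coord.tensorGrad K V y a - Coord.grad g VK y a = 0 := by
  set S := hg.metricAlgebra with hS
  set c : smoothAlgebra U := algebraMap ℝ _ (ħ ^ 2 / 2) with hc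
  have hcd : ∀ a, S.d a c = 0 := fun a => Derivation.map_algebraMap _ _
  have hce : ∀ y, eval y c = ħ ^ 2 / 2 := fun y => AlgHom.commutes _ _
  have hc0 : ħ ^ 2 / 2 ≠ 0 := by positivity
  set KA := resMatrix K hK with hKA
  have hKe : ∀ y a b, eval y (KA a b) = K y a b := fun _ _ _ => rfl
  have hKAs : KAᵀ = KA := Matrix.ext fun a b => ext_eval fun y => congrFun (congrFun (hKs y) a) b
  have hEe : ∀ y, eval y (res E hE) = E y := fun _ => rfl
  have hVe : ∀ y, eval y (res V hV) = V y := fun _ => rfl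
  have hEKe : ∀ y, eval y (res EK hEK) = EK y := fun _ => rfl
  have hVKe : ∀ y, eval y (res VK hVK) = VK y := fun _ => rfl
  -- The commutator and the two conditions, as elements of the algebra of smooth functions.
  set Q : smoothAlgebra U → smoothAlgebra U := fun f =>
    S.op c S.G (res E hE) (res V hV) (S.op c KA (res EK hEK) (res VK hVK) f)
      - S.op c KA (res EK hEK) (res VK hVK) (S.op c S.G (res E hE) (res V hV) f) with hQ
  set Z := S.correction c KA (res E hE) (res V hV) (res EK hEK) (res VK hVK) with hZ
  have hQe : ∀ (F : EuclideanSpace ℝ (Fin n) → ℝ) (f : smoothAlgebra U),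
      (∀ y, eval y f = F y) → ∀ y : U, eval y (Q f) =
        coordOp ħ g (Coord.metricInv g) E V (coordOp ħ g K EK VK F) y -
          coordOp ħ g K EK VK (coordOp ħ g (Coord.metricInv g) E V F) y := fun F f hf y => by
    rw [hQ, map_sub,
      hg.eval_op ħ (fun y a b => hg.eval_G y a b) hEe hVe (hg.eval_op ħ hKe hEKe hVKe hf),
      hg.eval_op ħ hKe hEKe hVKe (hg.eval_op ħ (fun y a b => hg.eval_G y a b) hEe hVe hf)]
  have hKill : S.IsKilling KA ↔ ∀ y ∈ U, ∀ a b c, Coord.covDerivUp g K a b c y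
      + Coord.covDerivUp g K b c a y + Coord.covDerivUp g K c a b y = 0 := by
    have he : ∀ (y : U) a b c, eval y (S.cu KA a b c + S.cu KA b c a + S.cu KA c a b) =
        Coord.covDerivUp g K a b c y + Coord.covDerivUp g K b c a y
          + Coord.covDerivUp g K c a b y := fun y a b c => by
      rw [map_add, map_add, hg.eval_cu hKe, hg.eval_cu hKe, hg.eval_cu hKe]
    constructor
    · intro h y hy a b c
      rw [← he ⟨y, hy⟩, h, map_zero]
    · intro h a b c
      exact ext_eval fun y => by rw [he, h y y.2, map_zero]
  have hCorr : Z = 0 ↔ ∀ y ∈ U, ∀ a,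
      ħ ^ 2 / 6 * Coord.divTensor g (Coord.ricciCommutator g K) y a
        + ħ ^ 2 / 2 * (Coord.grad g EK y a - Coord.tensorGrad K E y a)
        + Coord.tensorGrad K V y a - Coord.grad g VK y a = 0 := by
    have he := hg.eval_correction ħ hKe hEe hVe hEKe hVKe
    constructor
    · intro h y hy a
      have h1 := he ⟨y, hy⟩ a
      rw [show hg.metricAlgebra.correction _ KA (res E hE) (res V hV) (res EK hEK) (res VK hVK) = 0
        from h, Pi.zero_apply, map_zero] at h1
      linarith
    · intro h
      ext a : 1
      exact ext_eval fun y => by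
        rw [hZ, hS, he, h y y.2, Pi.zero_apply, map_zero, mul_zero]
  rw [← hKill, ← hCorr]
  constructor
  · intro h
    have hQ0 : ∀ F (hF : F ∈ 𝓕), Q (res F (h𝓕 F hF)) = 0 := fun F hF => ext_eval fun y => by
      rw [hQe F _ (fun _ => rfl), h F hF y y.2, sub_self, map_zero]
    have hd : ∀ (y : U) F (hF : F ∈ 𝓕) a, eval y (S.d a (res F (h𝓕 F hF))) =
        Coord.partialDeriv a F y := fun y F hF a => hg.eval_d a (fun _ => rfl) y
    -- A product of three functions that vanish at `y` isolates the principal symbol there.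
    have hk : S.IsKilling KA := fun i j k => ext_eval fun y => by
      obtain ⟨p, hp, hp0, hpd⟩ := h𝓕d y y.2 i
      obtain ⟨q, hq, hq0, hqd⟩ := h𝓕d y y.2 j
      obtain ⟨r, hr, hr0, hrd⟩ := h𝓕d y y.2 k
      have hpqr := h𝓕mul _ (h𝓕mul p hp q hq) r hr
      have h1 := S.eval_op_commutator_mul (eval y) hcd hKAs (res E hE) (res V hV) (res EK hEK)
        (res VK hVK) (res p (h𝓕 p hp)) (res q (h𝓕 q hq)) (res r (h𝓕 r hr)) i j k hp0 hq0 hr0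
        (fun a => (hd y p hp a).trans (hpd a)) (fun a => (hd y q hq a).trans (hqd a))
        (fun a => (hd y r hr a).trans (hrd a))
      have h2 : eval y (Q (res p (h𝓕 p hp) * res q (h𝓕 q hq) * res r (h𝓕 r hr))) = 0 := by
        rw [show res p (h𝓕 p hp) * res q (h𝓕 q hq) * res r (h𝓕 r hr) = res _ (h𝓕 _ hpqr) from rfl,
          hQ0 _ hpqr, map_zero]
      rw [show eval y (Q _) = _ from h1, hce] at h2
      rw [map_zero]
      exact (mul_eq_zero.mp h2).resolve_left (by positivity)
    refine ⟨hk, ?_⟩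
    -- A single function that vanishes at `y` isolates the first-order coefficients.
    ext i : 1
    refine ext_eval fun y => ?_
    obtain ⟨p, hp, hp0, hpd⟩ := h𝓕d y y.2 i
    have h1 := congrArg (eval y) (hk.op_commutator S hcd hKAs (res E hE) (res V hV) (res EK hEK)
      (res VK hVK) (res p (h𝓕 p hp)))
    have hdot : eval y (Z ⬝ᵥ S.df (res p (h𝓕 p hp))) = eval y (Z i) := by
      simp only [dotProduct, MetricAlgebra.df, map_sum, map_mul]
      rw [Finset.sum_congr rfl fun a _ => by rw [hd y p hp, hpd]]
      simp
    have h2 : (0 : ℝ) = 2 * (ħ ^ 2 / 2) * eval y (Z i) := by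
      calc
        (0 : ℝ) = eval y (3 * Q (res p (h𝓕 p hp))) := by rw [hQ0 p hp, mul_zero, map_zero]
        _ = _ := h1
        _ = _ := by
          rw [map_add, map_mul, map_mul, map_mul, map_mul, hdot, hce,
            show eval y (res p (h𝓕 p hp)) = 0 from hp0, map_ofNat]
          ring
    rw [Pi.zero_apply, map_zero]
    exact (mul_eq_zero.mp h2.symm).resolve_left (by positivity)
  · rintro ⟨hk, hz⟩ F hF y hy
    have h1 := congrArg (eval ⟨y, hy⟩) (hk.op_commutator S hcd hKAs (res E hE) (res V hV)
      (res EK hEK) (res VK hVK) (res F (h𝓕 F hF)))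
    rw [← hZ, hz, zero_dotProduct, map_mul] at h1
    have hdiv0 : S.div (0 : Fin n → smoothAlgebra U) = 0 := by simp [MetricAlgebra.div]
    rw [hdiv0, mul_zero, mul_zero, add_zero, map_zero, map_ofNat] at h1
    have h2 := (mul_eq_zero.mp h1).resolve_left (by norm_num)
    exact sub_eq_zero.mp ((hQe F (res F (h𝓕 F hF)) (fun _ => rfl) ⟨y, hy⟩).symm.trans h2)

end IsMetricOn

/-! ### Charts -/

section Charts

variable {n : ℕ} {M : Type*} [TopologicalSpace M] [ChartedSpace (EuclideanSpace ℝ (Fin n)) M]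

/-- The range of a chart, as an open set. -/
def chartTarget (φ : OpenPartialHomeomorph M (EuclideanSpace ℝ (Fin n))) :
    Opens (EuclideanSpace ℝ (Fin n)) := ⟨φ.target, φ.open_target⟩

theorem sum_coord_smul_single (v : EuclideanSpace ℝ (Fin n)) :
    v = ∑ e, v e • EuclideanSpace.single e (1 : ℝ) := by
  ext i; simp [Finset.sum_apply, Pi.single_apply]

/-- The inverse of a chart, differentiated. The tangent spaces are identified with `ℝⁿ`, which is
what they are by definition, to allow the base point to vary. -/
noncomputable def chartSymmDeriv (φ : OpenPartialHomeomorph M (EuclideanSpace ℝ (Fin n)))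
    (y : EuclideanSpace ℝ (Fin n)) : EuclideanSpace ℝ (Fin n) →L[ℝ] EuclideanSpace ℝ (Fin n) :=
  mfderiv (𝓡 n) (𝓡 n) φ.symm y

/-- A chart, differentiated. -/
noncomputable def chartDeriv (φ : OpenPartialHomeomorph M (EuclideanSpace ℝ (Fin n)))
    (x : M) : EuclideanSpace ℝ (Fin n) →L[ℝ] EuclideanSpace ℝ (Fin n) :=
  mfderiv (𝓡 n) (𝓡 n) φ x

/-- The metric as a family of bilinear forms on `ℝⁿ`. -/
def PseudoRiemannianMetric.form (g : PseudoRiemannianMetric n M) (x : M) :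
    EuclideanSpace ℝ (Fin n) →L[ℝ] EuclideanSpace ℝ (Fin n) →L[ℝ] ℝ := g.toFun x

/-- The tensor as a family of bilinear forms on the dual of `ℝⁿ`. -/
def SymmetricTwoTensor.form (K : SymmetricTwoTensor n M) (x : M) :
    (EuclideanSpace ℝ (Fin n) →L[ℝ] ℝ) →L[ℝ] (EuclideanSpace ℝ (Fin n) →L[ℝ] ℝ) →L[ℝ] ℝ :=
  K.toFun x

theorem PseudoRiemannianMetric.components_apply (g : PseudoRiemannianMetric n M)
    (φ : OpenPartialHomeomorph M (EuclideanSpace ℝ (Fin n))) (y : EuclideanSpace ℝ (Fin n))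
    (i j : Fin n) : g.components φ y i j =
      g.form (φ.symm y) (chartSymmDeriv φ y (EuclideanSpace.single i 1))
        (chartSymmDeriv φ y (EuclideanSpace.single j 1)) := rfl

theorem SymmetricTwoTensor.components_apply (K : SymmetricTwoTensor n M)
    (φ : OpenPartialHomeomorph M (EuclideanSpace ℝ (Fin n))) (y : EuclideanSpace ℝ (Fin n))
    (i j : Fin n) : K.components φ y i j =
      K.form (φ.symm y) ((EuclideanSpace.proj i).comp (chartDeriv φ (φ.symm y)))
        ((EuclideanSpace.proj j).comp (chartDeriv φ (φ.symm y))) := rfl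

theorem SymmetricTwoTensor.components_transpose (K : SymmetricTwoTensor n M)
    (φ : OpenPartialHomeomorph M (EuclideanSpace ℝ (Fin n))) (y : EuclideanSpace ℝ (Fin n)) :
    (K.components φ y)ᵀ = K.components φ y := by
  ext i j; exact K.symm _ _ _

theorem bilinear_eq_sum (B : EuclideanSpace ℝ (Fin n) →L[ℝ] EuclideanSpace ℝ (Fin n) →L[ℝ] ℝ)
    (L : EuclideanSpace ℝ (Fin n) →L[ℝ] EuclideanSpace ℝ (Fin n))
    (v w : EuclideanSpace ℝ (Fin n)) :
    B (L v) (L w) = ∑ i, ∑ j, v i * B (L (EuclideanSpace.single i 1))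
      (L (EuclideanSpace.single j 1)) * w j := by
  conv_lhs => rw [sum_coord_smul_single v, sum_coord_smul_single w]
  simp only [map_sum, map_smul, sum_apply, smul_apply,
    smul_eq_mul, Finset.mul_sum]
  rw [Finset.sum_comm]
  exact Finset.sum_congr rfl fun _ _ => Finset.sum_congr rfl fun _ _ => by ring

variable [IsManifold (𝓡 n) ∞ M]

theorem chartSymmDeriv_comp_chartDeriv {φ : OpenPartialHomeomorph M (EuclideanSpace ℝ (Fin n))}
    (hφ : φ ∈ atlas (EuclideanSpace ℝ (Fin n)) M) {y : EuclideanSpace ℝ (Fin n)}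
    (hy : y ∈ φ.target) (v : EuclideanSpace ℝ (Fin n)) :
    chartSymmDeriv φ y (chartDeriv φ (φ.symm y) v) = v := by
  have : IsManifold (𝓡 n) 1 M := IsManifold.of_le (n := ∞) (by norm_cast)
  have h := (mdifferentiable_of_mem_atlas (I := 𝓡 n) hφ).symm_comp_deriv (φ.map_target hy)
  rw [φ.right_inv hy] at h
  exact congrArg (fun L : EuclideanSpace ℝ (Fin n) →L[ℝ] EuclideanSpace ℝ (Fin n) => L v) h

theorem chartDeriv_comp_chartSymmDeriv {φ : OpenPartialHomeomorph M (EuclideanSpace ℝ (Fin n))}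
    (hφ : φ ∈ atlas (EuclideanSpace ℝ (Fin n)) M) {y : EuclideanSpace ℝ (Fin n)}
    (hy : y ∈ φ.target) (v : EuclideanSpace ℝ (Fin n)) :
    chartDeriv φ (φ.symm y) (chartSymmDeriv φ y v) = v := by
  have : IsManifold (𝓡 n) 1 M := IsManifold.of_le (n := ∞) (by norm_cast)
  have h := (mdifferentiable_of_mem_atlas (I := 𝓡 n) hφ).comp_symm_deriv hy
  exact congrArg (fun L : EuclideanSpace ℝ (Fin n) →L[ℝ] EuclideanSpace ℝ (Fin n) => L v) h

theorem PseudoRiemannianMetric.isMetricOn (g : PseudoRiemannianMetric n M)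
    {φ : OpenPartialHomeomorph M (EuclideanSpace ℝ (Fin n))}
    (hφ : φ ∈ atlas (EuclideanSpace ℝ (Fin n)) M) :
    IsMetricOn (chartTarget φ) (g.components φ) where
  smooth := g.smooth φ hφ
  symm y := by ext i j; exact g.symm _ _ _
  det_ne_zero y hdet := by
    obtain ⟨v, hv, hgv⟩ := Matrix.exists_mulVec_eq_zero_iff.mpr hdet
    apply hv
    have h0 : chartSymmDeriv φ y (WithLp.toLp 2 v) = 0 := by
      refine g.nondegenerate (φ.symm y) _ fun w => ?_
      change g.form (φ.symm y) _ w = 0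
      rw [← chartSymmDeriv_comp_chartDeriv hφ y.2 w, bilinear_eq_sum, Finset.sum_comm]
      refine Finset.sum_eq_zero fun j _ => ?_
      have h := congrFun hgv j
      simp only [Matrix.mulVec, dotProduct, Pi.zero_apply] at h
      rw [← Finset.sum_mul]
      refine mul_eq_zero_of_left (Eq.trans (Finset.sum_congr rfl fun i _ => ?_) h) _
      rw [g.components_apply, mul_comm]
      exact congrArg (· * v i) (g.symm _ _ _)
    have h1 := chartDeriv_comp_chartSymmDeriv hφ y.2 (WithLp.toLp 2 v)
    rw [h0, map_zero] at h1
    ext i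
    exact congrArg (fun u : EuclideanSpace ℝ (Fin n) => u i) h1.symm

/-! ### Independence of the chart -/

/-- The functions whose expression in every chart is smooth. -/
def SmoothInCharts (f : M → ℝ) : Prop :=
  ∀ φ ∈ atlas (EuclideanSpace ℝ (Fin n)) M, ContDiffOn ℝ ∞ (f ∘ φ.symm) (chartTarget φ)

theorem smoothInCharts_of_contMDiff {f : M → ℝ} (hf : ContMDiff (𝓡 n) 𝓘(ℝ) ∞ f) :
    SmoothInCharts (n := n) f := fun φ hφ => by
  have h := contMDiffOn_symm_of_mem_maximalAtlas
    (IsManifold.subset_maximalAtlas (I := 𝓡 n) (n := ∞) hφ)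
  exact contMDiffOn_iff_contDiffOn.mp (hf.comp_contMDiffOn h)

/-- The transition between two charts, on the open set where it is defined. -/
theorem transition_contDiffOn {φ ψ : OpenPartialHomeomorph M (EuclideanSpace ℝ (Fin n))}
    (hφ : φ ∈ atlas (EuclideanSpace ℝ (Fin n)) M) (hψ : ψ ∈ atlas (EuclideanSpace ℝ (Fin n)) M) :
    ContDiffOn ℝ ∞ (φ ∘ ψ.symm) (ψ.symm.trans φ).source := by
  have h1 := contMDiffOn_symm_of_mem_maximalAtlas
    (IsManifold.subset_maximalAtlas (I := 𝓡 n) (n := ∞) hψ)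
  have h2 := contMDiffOn_of_mem_maximalAtlas
    (IsManifold.subset_maximalAtlas (I := 𝓡 n) (n := ∞) hφ)
  refine contMDiffOn_iff_contDiffOn.mp (h2.comp (h1.mono ?_) ?_)
  · exact fun y hy => hy.1
  · exact fun y hy => hy.2

variable {φ ψ : OpenPartialHomeomorph M (EuclideanSpace ℝ (Fin n))}

theorem chartSymmDeriv_transition (hφ : φ ∈ atlas (EuclideanSpace ℝ (Fin n)) M)
    (hψ : ψ ∈ atlas (EuclideanSpace ℝ (Fin n)) M) {y : EuclideanSpace ℝ (Fin n)}
    (hy : y ∈ (ψ.symm.trans φ).source) (v : EuclideanSpace ℝ (Fin n)) :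
    chartSymmDeriv ψ y v =
      chartSymmDeriv φ ((φ ∘ ψ.symm) y) (fderiv ℝ (φ ∘ ψ.symm) y v) := by
  have : IsManifold (𝓡 n) 1 M := IsManifold.of_le (n := ∞) (by norm_cast)
  have hopen := (ψ.symm.trans φ).open_source
  have hT : MDifferentiableAt (𝓡 n) (𝓡 n) (φ ∘ ψ.symm) y :=
    (((transition_contDiffOn hφ hψ).contDiffAt (hopen.mem_nhds hy)).differentiableAt
      (by simp)).mdifferentiableAt
  have hφs : MDifferentiableAt (𝓡 n) (𝓡 n) φ.symm ((φ ∘ ψ.symm) y) :=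
    mdifferentiableAt_atlas_symm hφ (φ.map_source hy.2)
  have heq : ψ.symm =ᶠ[nhds y] φ.symm ∘ (φ ∘ ψ.symm) := by
    filter_upwards [hopen.mem_nhds hy] with z hz
    exact (φ.left_inv hz.2).symm
  have h := heq.mfderiv_eq (I := 𝓡 n) (I' := 𝓡 n)
  rw [mfderiv_comp y hφs hT, mfderiv_eq_fderiv] at h
  exact congrArg (fun L : EuclideanSpace ℝ (Fin n) →L[ℝ] EuclideanSpace ℝ (Fin n) => L v) h

theorem chartDeriv_transition (hφ : φ ∈ atlas (EuclideanSpace ℝ (Fin n)) M)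
    (hψ : ψ ∈ atlas (EuclideanSpace ℝ (Fin n)) M) {y : EuclideanSpace ℝ (Fin n)}
    (hy : y ∈ (ψ.symm.trans φ).source) (v : EuclideanSpace ℝ (Fin n)) :
    chartDeriv φ (ψ.symm y) v =
      fderiv ℝ (φ ∘ ψ.symm) y (chartDeriv ψ (ψ.symm y) v) := by
  have hz : (φ ∘ ψ.symm) y ∈ φ.target := φ.map_source hy.2
  have hx : φ.symm ((φ ∘ ψ.symm) y) = ψ.symm y := φ.left_inv hy.2
  have h := chartSymmDeriv_transition hφ hψ hy (chartDeriv ψ (ψ.symm y) v)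
  rw [chartSymmDeriv_comp_chartDeriv hψ hy.1] at h
  have h2 := chartDeriv_comp_chartSymmDeriv hφ hz
    (fderiv ℝ (φ ∘ ψ.symm) y (chartDeriv ψ (ψ.symm y) v))
  rw [← h, hx] at h2
  exact h2

/-- The Jacobian matrix of the transition between two charts. -/
noncomputable def jacobian (φ ψ : OpenPartialHomeomorph M (EuclideanSpace ℝ (Fin n)))
    (y : EuclideanSpace ℝ (Fin n)) : Matrix (Fin n) (Fin n) ℝ :=
  Matrix.of fun e c => fderiv ℝ (φ ∘ ψ.symm) y (EuclideanSpace.single c 1) e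

theorem PseudoRiemannianMetric.components_transition (g : PseudoRiemannianMetric n M)
    (hφ : φ ∈ atlas (EuclideanSpace ℝ (Fin n)) M) (hψ : ψ ∈ atlas (EuclideanSpace ℝ (Fin n)) M)
    {y : EuclideanSpace ℝ (Fin n)} (hy : y ∈ (ψ.symm.trans φ).source) :
    g.components ψ y =
      (jacobian φ ψ y)ᵀ * g.components φ ((φ ∘ ψ.symm) y) * jacobian φ ψ y := by
  have hx : φ.symm ((φ ∘ ψ.symm) y) = ψ.symm y := φ.left_inv hy.2
  ext i j
  rw [g.components_apply, chartSymmDeriv_transition hφ hψ hy, chartSymmDeriv_transition hφ hψ hy,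
    bilinear_eq_sum]
  simp only [Matrix.mul_apply, Matrix.transpose_apply, g.components_apply, hx, Finset.sum_mul,
    jacobian, Matrix.of_apply]
  rw [Finset.sum_comm]

theorem SymmetricTwoTensor.components_transition (K : SymmetricTwoTensor n M)
    (hφ : φ ∈ atlas (EuclideanSpace ℝ (Fin n)) M) (hψ : ψ ∈ atlas (EuclideanSpace ℝ (Fin n)) M)
    {y : EuclideanSpace ℝ (Fin n)} (hy : y ∈ (ψ.symm.trans φ).source) :
    K.components φ ((φ ∘ ψ.symm) y) =
      jacobian φ ψ y * K.components ψ y * (jacobian φ ψ y)ᵀ := by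
  have hx : φ.symm ((φ ∘ ψ.symm) y) = ψ.symm y := φ.left_inv hy.2
  have hcov : ∀ i, (EuclideanSpace.proj i : EuclideanSpace ℝ (Fin n) →L[ℝ] ℝ).comp
      (chartDeriv φ (ψ.symm y)) = ∑ a, jacobian φ ψ y i a •
        (EuclideanSpace.proj a : EuclideanSpace ℝ (Fin n) →L[ℝ] ℝ).comp
          (chartDeriv ψ (ψ.symm y)) := fun i => by
    ext v
    rw [ContinuousLinearMap.comp_apply, chartDeriv_transition hφ hψ hy,
      sum_coord_smul_single (chartDeriv ψ (ψ.symm y) v), map_sum, map_sum]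
    simp only [map_smul, smul_eq_mul, sum_apply,
      smul_apply, ContinuousLinearMap.comp_apply, jacobian, Matrix.of_apply]
    exact Finset.sum_congr rfl fun a _ => mul_comm _ _
  ext i j
  rw [K.components_apply, hx, hcov, hcov]
  simp only [map_sum, map_smul, sum_apply, smul_apply,
    smul_eq_mul, Matrix.mul_apply, Matrix.transpose_apply, K.components_apply ψ, Finset.sum_mul,
    Finset.mul_sum]
  exact Finset.sum_congr rfl fun _ _ => Finset.sum_congr rfl fun _ _ => by ring

theorem PseudoRiemannianMetric.metricInv_transition (g : PseudoRiemannianMetric n M)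
    (hφ : φ ∈ atlas (EuclideanSpace ℝ (Fin n)) M) (hψ : ψ ∈ atlas (EuclideanSpace ℝ (Fin n)) M)
    {y : EuclideanSpace ℝ (Fin n)} (hy : y ∈ (ψ.symm.trans φ).source) :
    Coord.metricInv (g.components φ) ((φ ∘ ψ.symm) y) =
      jacobian φ ψ y * Coord.metricInv (g.components ψ) y * (jacobian φ ψ y)ᵀ := by
  have hlaw := g.components_transition hφ hψ hy
  have hJ : IsUnit (jacobian φ ψ y).det := by
    have hdet := (g.isMetricOn hψ).det_ne_zero ⟨y, hy.1⟩
    rw [hlaw, Matrix.det_mul] at hdet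
    exact (right_ne_zero_of_mul hdet).isUnit
  have hJt : IsUnit ((jacobian φ ψ y)ᵀ).det := by rwa [Matrix.det_transpose]
  rw [Coord.metricInv, Coord.metricInv, hlaw, Matrix.mul_inv_rev, Matrix.mul_inv_rev,
    ← mul_assoc, Matrix.mul_nonsing_inv _ hJ, one_mul, mul_assoc, Matrix.nonsing_inv_mul _ hJt,
    mul_one]

/-- The operator `Δ_T`, computed in two charts, for `T` with the transformation law of a contravariant
2-tensor. -/
theorem tensorLaplacian_transition (g : PseudoRiemannianMetric n M)
    (hφ : φ ∈ atlas (EuclideanSpace ℝ (Fin n)) M) (hψ : ψ ∈ atlas (EuclideanSpace ℝ (Fin n)) M)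
    {T T' : EuclideanSpace ℝ (Fin n) → Matrix (Fin n) (Fin n) ℝ}
    (hT : ∀ a b, ContDiffOn ℝ ∞ (fun y => T y a b) (chartTarget ψ))
    (hT' : ∀ a b, ContDiffOn ℝ ∞ (fun y => T' y a b) (chartTarget φ))
    (hTT' : ∀ y ∈ (ψ.symm.trans φ).source, T' ((φ ∘ ψ.symm) y) =
      jacobian φ ψ y * T y * (jacobian φ ψ y)ᵀ)
    {f : M → ℝ} (hf : SmoothInCharts (n := n) f) {x : M} (hxφ : x ∈ φ.source)
    (hxψ : x ∈ ψ.source) :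
    Coord.tensorLaplacian (g.components ψ) T (f ∘ ψ.symm) (ψ x) =
      Coord.tensorLaplacian (g.components φ) T' (f ∘ φ.symm) (φ x) := by
  let U : Opens (EuclideanSpace ℝ (Fin n)) :=
    ⟨(ψ.symm.trans φ).source, (ψ.symm.trans φ).open_source⟩
  have hUψ : (U : Set (EuclideanSpace ℝ (Fin n))) ⊆ chartTarget ψ := fun y hy => hy.1
  have hgψ := g.isMetricOn hψ
  have hg : IsMetricOn U (g.components ψ) :=
    ⟨fun a b => (hgψ.smooth a b).mono hUψ, fun y => hgψ.symm ⟨y, hUψ y.2⟩,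
      fun y => hgψ.det_ne_zero ⟨y, hUψ y.2⟩⟩
  have hxU : ψ x ∈ U := ⟨ψ.map_source hxψ, by
    change ψ.symm (ψ x) ∈ φ.source
    rwa [ψ.left_inv hxψ]⟩
  have h := tensorLaplacian_comp hg (g.isMetricOn hφ) (fun a b => (hT a b).mono hUψ) hT'
    (transition_contDiffOn hφ hψ) (fun y hy => φ.map_source hy.2) (J := jacobian φ ψ)
    (fun _ _ _ => rfl) (fun y hy => g.components_transition hφ hψ hy) hTT' (hf φ hφ)
    (F := f ∘ ψ.symm)
    (fun y hy => congrArg f (φ.left_inv hy.2).symm) hxU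
  rw [h, Function.comp_apply, ψ.left_inv hxψ]

theorem laplaceBeltrami_eq (g : PseudoRiemannianMetric n M)
    (hφ : φ ∈ atlas (EuclideanSpace ℝ (Fin n)) M) {f : M → ℝ} (hf : SmoothInCharts (n := n) f)
    {y : EuclideanSpace ℝ (Fin n)} (hy : y ∈ φ.target) :
    laplaceBeltrami g f (φ.symm y) = Coord.tensorLaplacian (g.components φ)
      (Coord.metricInv (g.components φ)) (f ∘ φ.symm) y := by
  have hψ := chart_mem_atlas (EuclideanSpace ℝ (Fin n)) (φ.symm y)
  have h := tensorLaplacian_transition g hφ hψ (g.isMetricOn hψ).contDiffOn_metricInv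
    (g.isMetricOn hφ).contDiffOn_metricInv (fun y hy => g.metricInv_transition hφ hψ hy) hf
    (φ.map_target hy) (mem_chart_source _ _)
  rw [φ.right_inv hy] at h
  exact h

theorem tensorLaplaceBeltrami_eq (g : PseudoRiemannianMetric n M) (K : SymmetricTwoTensor n M)
    (hφ : φ ∈ atlas (EuclideanSpace ℝ (Fin n)) M) {f : M → ℝ} (hf : SmoothInCharts (n := n) f)
    {y : EuclideanSpace ℝ (Fin n)} (hy : y ∈ φ.target) :
    tensorLaplaceBeltrami g K f (φ.symm y) = Coord.tensorLaplacian (g.components φ)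
      (K.components φ) (f ∘ φ.symm) y := by
  have hψ := chart_mem_atlas (EuclideanSpace ℝ (Fin n)) (φ.symm y)
  have h := tensorLaplacian_transition g hφ hψ (K.smooth _ hψ)
    (K.smooth _ hφ) (fun y hy => K.components_transition hφ hψ hy) hf
    (φ.map_target hy) (mem_chart_source _ _)
  rw [φ.right_inv hy] at h
  exact h

theorem modifiedHamiltonian_eq (ħ : ℝ) (g : PseudoRiemannianMetric n M) (E V : M → ℝ)
    (hφ : φ ∈ atlas (EuclideanSpace ℝ (Fin n)) M) {f : M → ℝ} (hf : SmoothInCharts (n := n) f)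
    {y : EuclideanSpace ℝ (Fin n)} (hy : y ∈ φ.target) :
    modifiedHamiltonian ħ g E V f (φ.symm y) = coordOp ħ (g.components φ)
      (Coord.metricInv (g.components φ)) (E ∘ φ.symm) (V ∘ φ.symm) (f ∘ φ.symm) y := by
  rw [modifiedHamiltonian, laplaceBeltrami_eq g hφ hf hy]; rfl

theorem modifiedOperator_eq (ħ : ℝ) (g : PseudoRiemannianMetric n M) (K : SymmetricTwoTensor n M)
    (E V : M → ℝ) (hφ : φ ∈ atlas (EuclideanSpace ℝ (Fin n)) M) {f : M → ℝ}
    (hf : SmoothInCharts (n := n) f) {y : EuclideanSpace ℝ (Fin n)} (hy : y ∈ φ.target) :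
    modifiedOperator ħ g K E V f (φ.symm y) = coordOp ħ (g.components φ)
      (K.components φ) (E ∘ φ.symm) (V ∘ φ.symm) (f ∘ φ.symm) y := by
  rw [modifiedOperator, tensorLaplaceBeltrami_eq g K hφ hf hy]; rfl

theorem SmoothInCharts.modifiedHamiltonian {ħ : ℝ} {g : PseudoRiemannianMetric n M} {E V f : M → ℝ}
    (hE : SmoothInCharts (n := n) E) (hV : SmoothInCharts (n := n) V)
    (hf : SmoothInCharts (n := n) f) :
    SmoothInCharts (n := n) (modifiedHamiltonian ħ g E V f) := fun φ hφ =>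
  ((g.isMetricOn hφ).contDiffOn_coordOp ħ (g.isMetricOn hφ).contDiffOn_metricInv (hE φ hφ) (hV φ hφ)
    (hf φ hφ)).congr fun _ hy => modifiedHamiltonian_eq ħ g E V hφ hf hy

theorem SmoothInCharts.modifiedOperator {ħ : ℝ} {g : PseudoRiemannianMetric n M}
    {K : SymmetricTwoTensor n M} {E V f : M → ℝ} (hE : SmoothInCharts (n := n) E)
    (hV : SmoothInCharts (n := n) V) (hf : SmoothInCharts (n := n) f) :
    SmoothInCharts (n := n) (modifiedOperator ħ g K E V f) := fun φ hφ =>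
  ((g.isMetricOn hφ).contDiffOn_coordOp ħ (K.smooth φ hφ) (hE φ hφ) (hV φ hφ)
    (hf φ hφ)).congr fun _ hy => modifiedOperator_eq ħ g K E V hφ hf hy

theorem coordOp_congr {U : Opens (EuclideanSpace ℝ (Fin n))} (ħ : ℝ)
    (g T : EuclideanSpace ℝ (Fin n) → Matrix (Fin n) (Fin n) ℝ)
    (E V : EuclideanSpace ℝ (Fin n) → ℝ) {F F' : EuclideanSpace ℝ (Fin n) → ℝ}
    (h : ∀ y ∈ U, F y = F' y) {y : EuclideanSpace ℝ (Fin n)} (hy : y ∈ U) :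
    coordOp ħ g T E V F y = coordOp ħ g T E V F' y := by
  have h1 : ∀ z ∈ U, ∀ a, Coord.tensorGrad T F z a = Coord.tensorGrad T F' z a := fun z hz a => by
    simp only [Coord.tensorGrad, smoothAlgebra.partialDeriv_congr _ h hz]
  simp only [coordOp, Coord.tensorLaplacian, Coord.divVector, h y hy, h1 y hy,
    smoothAlgebra.partialDeriv_congr _ (fun z hz => h1 z hz _) hy]

/-! ### Test functions -/

/-- A globally defined smooth function that is the `i`-th coordinate, up to a constant, near a given
point: the coordinate multiplied by a bump function. -/
theorem exists_smooth_coordinate [T2Space M] (hφ : φ ∈ atlas (EuclideanSpace ℝ (Fin n)) M)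
    {y : EuclideanSpace ℝ (Fin n)} (hy : y ∈ φ.target) (i : Fin n) :
    ∃ f : M → ℝ, ContMDiff (𝓡 n) 𝓘(ℝ) ∞ f ∧ (f ∘ φ.symm) y = 0 ∧
      ∀ a, Coord.partialDeriv a (f ∘ φ.symm) y = if a = i then 1 else 0 := by
  obtain ⟨χ, -, hχ⟩ := (SmoothBumpFunction.nhds_basis_tsupport (I := 𝓡 n) (φ.symm y)).mem_iff.mp
    (φ.open_source.mem_nhds (φ.map_target hy))
  have hφs := contMDiffOn_of_mem_maximalAtlas
    (IsManifold.subset_maximalAtlas (I := 𝓡 n) (n := ∞) hφ)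
  have hlin : ContMDiff (𝓡 n) 𝓘(ℝ) ∞ (fun z : EuclideanSpace ℝ (Fin n) => z i - y i) := by
    refine contMDiff_iff_contDiff.mpr ?_
    exact (EuclideanSpace.proj (𝕜 := ℝ) i).contDiff.sub contDiff_const
  refine ⟨fun x => χ x * (φ x i - y i), ?_, ?_, fun a => ?_⟩
  · refine contMDiff_of_tsupport fun x hx => ?_
    have hxφ : x ∈ φ.source := hχ (tsupport_mul_subset_left hx)
    exact χ.contMDiff.contMDiffAt.mul
      ((hlin.comp_contMDiffOn hφs).contMDiffAt (φ.open_source.mem_nhds hxφ))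
  · simp [φ.right_inv hy]
  · have heq : (fun x => χ x * (φ x i - y i)) ∘ φ.symm =ᶠ[nhds y]
        fun z => z i - y i := by
      have hχ1 : ∀ᶠ z in nhds y, χ (φ.symm z) = 1 :=
        (φ.continuousAt_symm hy).eventually χ.eventuallyEq_one
      filter_upwards [hχ1, φ.open_target.mem_nhds hy] with z hz hzt
      simp [hz, φ.right_inv hzt]
    have hd : HasFDerivAt (fun z : EuclideanSpace ℝ (Fin n) => z i - y i)
        (EuclideanSpace.proj (𝕜 := ℝ) i) y :=
      (EuclideanSpace.proj (𝕜 := ℝ) i).hasFDerivAt.sub_const _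
    rw [Coord.partialDeriv, heq.fderiv_eq, hd.fderiv]
    simp [eq_comm]

end Charts

theorem theorem1 (n : ℕ) (M : Type*) [TopologicalSpace M] [T2Space M]
    [ChartedSpace (EuclideanSpace ℝ (Fin n)) M] [IsManifold (𝓡 n) ∞ M]
    (g : PseudoRiemannianMetric n M) (K : SymmetricTwoTensor n M) (ħ : ℝ) (hħ : ħ ≠ 0)
    (E V EK VK : M → ℝ)
    (hE : ContMDiff (𝓡 n) 𝓘(ℝ) ∞ E) (hV : ContMDiff (𝓡 n) 𝓘(ℝ) ∞ V)
    (hEK : ContMDiff (𝓡 n) 𝓘(ℝ) ∞ EK) (hVK : ContMDiff (𝓡 n) 𝓘(ℝ) ∞ VK) :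
    CommuteOnSmooth (n := n) (modifiedHamiltonian ħ g E V) (modifiedOperator ħ g K EK VK) ↔
      IsKillingTensor g K ∧ QuantumCorrectionEquation ħ g K E V EK VK := by
  have hE' := smoothInCharts_of_contMDiff hE
  have hV' := smoothInCharts_of_contMDiff hV
  have hEK' := smoothInCharts_of_contMDiff hEK
  have hVK' := smoothInCharts_of_contMDiff hVK
  have hHK : ∀ φ ∈ atlas (EuclideanSpace ℝ (Fin n)) M, ∀ f : M → ℝ, SmoothInCharts (n := n) f →
      ∀ y ∈ chartTarget φ,
      modifiedHamiltonian ħ g E V (modifiedOperator ħ g K EK VK f) (φ.symm y) =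
        coordOp ħ (g.components φ) (Coord.metricInv (g.components φ)) (E ∘ φ.symm) (V ∘ φ.symm)
          (coordOp ħ (g.components φ) (K.components φ) (EK ∘ φ.symm) (VK ∘ φ.symm) (f ∘ φ.symm))
          y := fun φ hφ f hf y hy => by
    rw [modifiedHamiltonian_eq ħ g E V hφ (.modifiedOperator hEK' hVK' hf) hy]
    exact coordOp_congr ħ _ _ _ _
      (fun z (hz : z ∈ chartTarget φ) => modifiedOperator_eq ħ g K EK VK hφ hf hz) hy
  have hKH : ∀ φ ∈ atlas (EuclideanSpace ℝ (Fin n)) M, ∀ f : M → ℝ, SmoothInCharts (n := n) f →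
      ∀ y ∈ chartTarget φ,
      modifiedOperator ħ g K EK VK (modifiedHamiltonian ħ g E V f) (φ.symm y) =
        coordOp ħ (g.components φ) (K.components φ) (EK ∘ φ.symm) (VK ∘ φ.symm)
          (coordOp ħ (g.components φ) (Coord.metricInv (g.components φ)) (E ∘ φ.symm)
            (V ∘ φ.symm) (f ∘ φ.symm)) y := fun φ hφ f hf y hy => by
    rw [modifiedOperator_eq ħ g K EK VK hφ (.modifiedHamiltonian hE' hV' hf) hy]
    exact coordOp_congr ħ _ _ _ _
      (fun z (hz : z ∈ chartTarget φ) => modifiedHamiltonian_eq ħ g E V hφ hf hz) hy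
  have hcoord := fun φ (hφ : φ ∈ atlas (EuclideanSpace ℝ (Fin n)) M) =>
    (g.isMetricOn hφ).commute_iff hħ (K := K.components φ) (K.smooth φ hφ) (fun y => K.components_transpose φ y)
      (hE' φ hφ) (hV' φ hφ) (hEK' φ hφ) (hVK' φ hφ)
      {F | ∃ f : M → ℝ, ContMDiff (𝓡 n) 𝓘(ℝ) ∞ f ∧ f ∘ φ.symm = F}
      (by rintro _ ⟨f, hf, rfl⟩; exact smoothInCharts_of_contMDiff hf φ hφ)
      (by rintro _ ⟨f, hf, rfl⟩ _ ⟨f', hf', rfl⟩; exact ⟨fun x => f x * f' x, hf.mul hf', rfl⟩)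
      (fun y hy i => by
        obtain ⟨f, hf, h0, hd⟩ := exists_smooth_coordinate hφ hy i
        exact ⟨_, ⟨f, hf, rfl⟩, h0, hd⟩)
  constructor
  · intro h
    have hc := fun φ hφ => (hcoord φ hφ).mp (by
      rintro _ ⟨f, hf, rfl⟩ y hy
      have hf' := smoothInCharts_of_contMDiff hf
      rw [← hHK φ hφ f hf' y hy, ← hKH φ hφ f hf' y hy, h f hf])
    exact ⟨fun φ hφ => (hc φ hφ).1, fun φ hφ => (hc φ hφ).2⟩
  · rintro ⟨hk, hz⟩ f hf
    ext x
    have hφ := chart_mem_atlas (EuclideanSpace ℝ (Fin n)) x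
    have hx := mem_chart_source (EuclideanSpace ℝ (Fin n)) x
    have hf' := smoothInCharts_of_contMDiff hf
    have hxt := (chartAt (EuclideanSpace ℝ (Fin n)) x).map_source hx
    rw [← (chartAt (EuclideanSpace ℝ (Fin n)) x).left_inv hx, hHK _ hφ f hf' _ hxt,
      hKH _ hφ f hf' _ hxt]
    exact (hcoord _ hφ).mpr ⟨hk _ hφ, hz _ hφ⟩ _ ⟨f, hf, rfl⟩ _ hxt
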